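/- Let $c,c_2>0$ and $0<T<T^*$, and put $\lambda=T^*/T-1$, $k=c_2/(c\lambda)$. For $a>0$ let $f^a_t(x)=\mathbf 1_{\{x>0\}}\,\frac{at}{\sqrt{2\pi}\,x^{3/2}}\exp\bigl(-\tfrac{a^2t^2}{2x}\bigr)$, and let a stable-1/2 subordinator with activity parameter $a$ be an increasing Lévy process $\{S_t\}$ such that $S_t$ has density $f^a_t$ for $t>0$. A càdlàg process $\{\xi_{tT}\}_{0\le t\le T}$ starting at $0$ is a stable-1/2 random bridge with activity parameter $a$ and terminal density $q$ on $(0,\infty)$ if $\xi_{TT}$ has density $q$ and, for some stable-1/2 subordinator $\{S_t\}$ with activity parameter $a$, for all $0<t_1<\dots<t_n<T$ and $(x_1,\dots,x_n)\in\mathbb R^n$, $$\mathbb Q[\xi_{t_1T}\le x_1,\dots,\xi_{t_nT}\le x_n\mid \xi_{TT}=z]=\mathbb Q[S_{t_1}\le x_1,\dots,S_{t_n}\le x_n\mid S_T=z]$$ for $q(z)\,dz$-almost every $z$. Put $f^a_{tT}(y;z)=f^a_t(y)f^a_{T-t}(z-y)/f^a_T(z)$. Let $\{S(t,T^*)\}_{0\le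 t\le T^*}$ be a stable-1/2 random bridge with activity parameter $c$ and terminal density $p$ on $(0,\infty)$, and for $0\le t\le T$ define $$\xi^{(1)}_{tT}=S(t,T^*),\qquad \xi^{(2)}_{tT}=k^2S(\lambda t+T,T^*)-k^2S(T,T^*).$$ (i) $\{\xi^{(1)}_{tT}\}$ is a stable-1/2 random bridge with activity parameter $c$ and terminal density $p^{(1)}(x)=\int_0^\infty f^c_{T,T^*}(x;z)\,p(z)\,dz$. (ii) $\{\xi^{(2)}_{tT}\}$ is a stable-1/2 random bridge with activity parameter $c_2$ and terminal density $p^{(2)}(x)=k^{-2}\int_0^\infty f^{c_2}_{T,\lambda^{-1}T^*}(x;z)\,p(k^{-2}z)\,dz$. (iii) Suppose $\mathbb E[S(T^*,T^*)]<\infty$. Then $\xi^{(1)}_{TT},\xi^{(2)}_{TT}$ are integrable. Let $0\le t<T$, let $\mathcal F_t$ be generated by $\{(\xi^{(1)}_{sT},\xi^{(2)}_{sT})\}_{0\le s\le t}$, and put $U^{(i)}_{tT}(x_1,x_2)=\mathbb E[\xi^{(i)}_{TT}\mid\xi^{(1)}_{tT}=x_1,\xi^{(2)}_{tT}=x_2]$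 and $M_t(y)=\mathbb E[S(T^*,T^*)\mid S((1+\lambda)t,T^*)=y]$. Then $\mathbb E[\xi^{(i)}_{TT}\mid\mathcal F_t]=U^{(i)}_{tT}(\xi^{(1)}_{tT},\xi^{(2)}_{tT})$ almost surely for $i=1,2$, and for almost every value $(x_1,x_2)$ of $(\xi^{(1)}_{tT},\xi^{(2)}_{tT})$, with $y=x_1+k^{-2}x_2$, $$U^{(1)}_{tT}(x_1,x_2)=\frac{T-t}{T^*-(1+\lambda)t}\bigl(M_t(y)-k^{-2}x_2\bigr)+\frac{T^*-(T+\lambda t)}{T^*-(1+\lambda)t}\,x_1,$$ $$U^{(2)}_{tT}(x_1,x_2)=k^2\,\frac{T^*-(T+\lambda t)}{T^*-(1+\lambda)t}\bigl(M_t(y)-x_1\bigr)+\frac{T-t}{T^*-(1+\lambda)t}\,x_2,$$ $$M_t(y)=\int_0^\infty z\,p_t(z)\,dz,\qquad p_t(z)=\mathbf 1_{\{z>y\}}K^{-1}\Bigl(\frac{z}{z-y}\Bigr)^{3/2}\exp\Bigl(-\frac{c^2}{2}\Bigl(\frac{(T^*-(1+\lambda)t)^2}{z-y}-\frac{T^{*2}}{z}\Bigr)\Bigr)p(z),$$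 where $K$ (depending on $t$ and $y$) is the constant for which $p_t$ is a probability density on $(0,\infty)$, and the integral defining $M_t(y)$ converges. -/

import Mathlib

open MeasureTheory ProbabilityTheory Filter Topology Set
open scoped NNReal ENNReal

/-- The density `f_t(x)` at time `t` of the stable-1/2 subordinator with activity parameter `c`
(a Lévy distribution). -/
noncomputable def stableHalfDensity (c t x : ℝ) : ℝ :=
  if 0 < x then
    c * t / (Real.sqrt (2 * Real.pi) * x ^ (3 / 2 : ℝ)) * Real.exp (-(1 / 2) * (c ^ 2 * t ^ 2 / x))
  else 0

/-- The density `f_{tT}(y; z) = f_t(y) f_{T-t}(z-y) / f_T(z)`, at time `t`, of the stable-1/2 bridge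
with activity parameter `c` to the value `z` at time `T`. -/
noncomputable def stableHalfBridgeDensity (c t T y z : ℝ) : ℝ :=
  stableHalfDensity c t y * stableHalfDensity c (T - t) (z - y) / stableHalfDensity c T z

/-- A stable-1/2 subordinator with activity parameter `c`: a Lévy process with càdlàg,
nondecreasing paths (left limits are then automatic) whose increments over intervals of length `h`
have density `f_h`. -/
structure IsStableHalfSubordinator {Ω : Type*} [MeasurableSpace Ω] (c : ℝ) (S : ℝ≥0 → Ω → ℝ)
    (P : Measure Ω) : Prop where
  measurable : ∀ t, Measurable (S t)
  start : ∀ ω, S 0 ω = 0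
  mono : ∀ ω, Monotone fun t => S t ω
  rightCts : ∀ ω t, ContinuousWithinAt (fun s => S s ω) (Ici t) t
  indep : HasIndepIncrements S P
  law : ∀ s t : ℝ≥0, s < t → P.map (fun ω => S t ω - S s ω) =
    volume.withDensity fun x => ENNReal.ofReal (stableHalfDensity c (t - s) x)

/-- The measure on `(0, ∞)` with density `p` (only the values of `p` on `(0, ∞)` matter). -/
noncomputable def lawOfDensity (p : ℝ → ℝ) : Measure ℝ :=
  (volume.restrict (Ioi 0)).withDensity fun z => ENNReal.ofReal (p z)

/-- `ξ`, considered on `[0, T]`, is a stable-1/2 random bridge with terminal density `p` and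
activity parameter `c`: its terminal value has density `p` on `(0, ∞)` and, for some stable-1/2
subordinator `S` with activity parameter `c`, the conditional finite-dimensional distribution
functions of `ξ` given `ξ_T = z` are those of `S` given `S_T = z`, for almost every `z` under the
terminal law. (The law of `S_T` is equivalent to Lebesgue measure on `(0, ∞)`, so the conditional
law given `S_T = z` is determined for almost every `z` under the terminal law.)
Processes start at `0` and have càdlàg paths. -/
structure IsStableHalfRandomBridge {Ω : Type*} [MeasurableSpace Ω] (c T : ℝ) (p : ℝ → ℝ)
    (ξ : ℝ → Ω → ℝ) (P : Measure Ω) [IsProbabilityMeasure P] : Prop where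
  measurable : ∀ t ∈ Icc 0 T, Measurable (ξ t)
  start : ∀ᵐ ω ∂P, ξ 0 ω = 0
  rightCts : ∀ ω, ∀ t ∈ Ico 0 T, ContinuousWithinAt (fun s => ξ s ω) (Ici t) t
  leftLim : ∀ ω, ∀ t ∈ Ioc 0 T, ∃ l : ℝ, Tendsto (fun s => ξ s ω) (𝓝[<] t) (𝓝 l)
  density_measurable : Measurable p
  density_nonneg : ∀ z, 0 < z → 0 ≤ p z
  terminal_law : P.map (ξ T) = lawOfDensity p
  bridge_law : ∃ (Ω' : Type) (_ : MeasurableSpace Ω') (P' : Measure Ω')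
    (_ : IsProbabilityMeasure P') (S : ℝ≥0 → Ω' → ℝ), IsStableHalfSubordinator c S P' ∧
      ∀ (n : ℕ) (t : Fin n → ℝ), StrictMono t → (∀ i, t i ∈ Ioo 0 T) →
        ∀ x : Fin n → ℝ, ∀ᵐ z ∂(lawOfDensity p),
          condDistrib (fun ω i => ξ (t i) ω) (ξ T) P z {y | ∀ i, y i ≤ x i} =
          condDistrib (fun ω i => S (t i).toNNReal ω) (S T.toNNReal) P' z {y | ∀ i, y i ≤ x i}

/-- The conditional mean `E[Y | X = x]`, computed with the regular conditional distribution of `Y`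
given `X`. -/
noncomputable def condMeanGiven {Ω E : Type*} [MeasurableSpace Ω] [MeasurableSpace E]
    (Y : Ω → ℝ) (X : Ω → E) (P : Measure Ω) [IsProbabilityMeasure P] (x : E) : ℝ :=
  ∫ y, y ∂(condDistrib Y X P x)

/-- The σ-algebra generated by the processes `ξ₁` and `ξ₂` up to time `t`. -/
@[reducible] def jointHistory {Ω : Type*} (ξ₁ ξ₂ : ℝ → Ω → ℝ) (t : ℝ) : MeasurableSpace Ω :=
  ⨆ s ∈ Icc 0 t, (MeasurableSpace.comap (ξ₁ s) inferInstance ⊔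
    MeasurableSpace.comap (ξ₂ s) inferInstance)

/-- The unnormalised density at `z` of the terminal value, at time `Tstar`, of a stable-1/2 random
bridge with terminal density `p`, given that its value at time `u` is `y`. -/
noncomputable def posteriorWeight (c Tstar : ℝ) (p : ℝ → ℝ) (u y z : ℝ) : ℝ :=
  if y < z then
    (z / (z - y)) ^ (3 / 2 : ℝ) *
      Real.exp (-(c ^ 2 / 2) * ((Tstar - u) ^ 2 / (z - y) - Tstar ^ 2 / z)) * p z
  else 0

/-- The normalised density `K⁻¹ * posteriorWeight`, with `K` the total mass on `(0, ∞)`. -/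
noncomputable def posteriorDensity (c Tstar : ℝ) (p : ℝ → ℝ) (u y z : ℝ) : ℝ :=
  (∫ v in Ioi 0, posteriorWeight c Tstar p u y v)⁻¹ * posteriorWeight c Tstar p u y z

/-!
A stable-1/2 random bridge is a stable-1/2 subordinator whose path law up to the terminal time `T`
has been reweighted by the likelihood ratio `g (S T)`, `g = p / f_T`, of the two terminal laws.
Increments of a subordinator over an interval are independent of the increments outside it, so
integrating out the latter replaces `g` by another function of the increment alone. Together with
the scaling `k² S(λ t) ~ S'(t)`, where `S'` has activity `k c λ`, this shows that affine time
changes of increments of a bridge are again bridges.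

For the conditional means, Bayes' formula shows that, given the paths of `S` up to time `t` and of
its increments from `T` to `T + λ t`, the terminal value depends only on
`S(t) + (S(T + λ t) - S(T))`. What then remains to the terminal value is the sum of the increments
over the two gaps `[t, T]` and `[T + λ t, T*]`. Increments over intervals of equal length are
exchangeable, so the conditional mean of the increment over part of the gaps is additive in its
length, and being monotone it is proportional to the length.
-/

section IndependentIncrements

variable {Ω T E : Type*}

theorem exists_monotone_nat_covering [LinearOrder T] [Nonempty T] (K : Finset T) :
    ∃ τ : ℕ → T, Monotone τ ∧ ∃ n, ∀ p ∈ K, ∃ i ≤ n, τ i = p := by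
  rcases K.eq_empty_or_nonempty with rfl | hK
  · exact ⟨fun _ => Classical.arbitrary T, monotone_const, 0, by simp⟩
  obtain ⟨n, hn⟩ : ∃ n, K.card = n + 1 := ⟨K.card - 1, by have := hK.card_pos; omega⟩
  refine ⟨fun i => K.orderEmbOfFin hn ⟨min i n, by omega⟩, fun i j hij => ?_, n, fun p hp => ?_⟩
  · exact (K.orderEmbOfFin hn).monotone (Fin.mk_le_mk.2 (min_le_min_right n hij))
  · obtain ⟨i, rfl⟩ : p ∈ range (K.orderEmbOfFin hn) := by rwa [K.range_orderEmbOfFin hn]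
    exact ⟨i, by omega, congrArg _ (Fin.ext (min_eq_left (by omega)))⟩

variable [LinearOrder T] [AddCommGroup E] [MeasurableSpace E] [MeasurableAdd₂ E]

theorem measurable_comap_grid_increments (X : T → Ω → E) {τ : ℕ → T} (hτ : Monotone τ)
    {A : Finset ℕ} {a b : ℕ} (hA : ∀ j, a ≤ j → j < b → τ j < τ (j + 1) → j ∈ A)
    (hab : τ a ≤ τ b) :
    Measurable[MeasurableSpace.comap (fun ω (j : A) => X (τ (j + 1)) ω - X (τ j) ω) inferInstance]
      fun ω => X (τ b) ω - X (τ a) ω := by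
  have htelescope : (fun ω => X (τ b) ω - X (τ a) ω) =
      fun ω => ∑ j ∈ Finset.Ico a (max a b), (X (τ (j + 1)) ω - X (τ j) ω) := by
    funext ω
    rw [Finset.sum_Ico_sub (fun j => X (τ j) ω) (le_max_left a b), hτ.map_max, max_eq_right hab]
  rw [htelescope]
  refine @Finset.measurable_sum _ _ _ _ _ _ (_) _ _ fun j hj => ?_
  have hj' : a ≤ j ∧ j < b := by rw [Finset.mem_Ico] at hj; omega
  rcases (hτ j.le_succ).eq_or_lt with heq | hlt
  · simp only [Nat.succ_eq_add_one] at heq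
    simp only [← heq, sub_self, measurable_const]
  · exact (measurable_pi_apply (X := fun _ : A => E) ⟨j, hA j hj'.1 hj'.2 hlt⟩).comp
      (comap_measurable fun ω (j : A) => X (τ (j + 1)) ω - X (τ j) ω)

theorem indepFun_increments_of_disjoint [Nonempty T] [MeasurableSub₂ E] [MeasurableSpace Ω]
    {P : Measure Ω} [IsProbabilityMeasure P] {X : T → Ω → E} (hmeas : ∀ t, Measurable (X t))
    (hX : HasIndepIncrements X P) {I J : Type*} {u v : I → T} {u' v' : J → T}
    (huv : ∀ i, u i ≤ v i) (huv' : ∀ j, u' j ≤ v' j)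
    (hdisj : ∀ i j, Disjoint (Ioc (u i) (v i)) (Ioc (u' j) (v' j))) :
    IndepFun (fun ω i => X (v i) ω - X (u i) ω) (fun ω j => X (v' j) ω - X (u' j) ω) P := by
  classical
  refine IndepFun.process_indepFun_process (X := fun i ω => X (v i) ω - X (u i) ω)
    (Y := fun j ω => X (v' j) ω - X (u' j) ω) (fun i => (hmeas _).sub (hmeas _))
    (fun j => (hmeas _).sub (hmeas _)) fun K L => ?_
  obtain ⟨τ, hτ, n, hn⟩ := exists_monotone_nat_covering
    (K.image u ∪ K.image v ∪ (L.image u' ∪ L.image v'))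
  set A := (Finset.range n).filter fun j => τ j < τ (j + 1) ∧ ∃ i, τ (j + 1) ∈ Ioc (u i) (v i)
  set B := (Finset.range n).filter fun j => τ j < τ (j + 1) ∧ ∃ i, τ (j + 1) ∈ Ioc (u' i) (v' i)
  have hAB : Disjoint A B := by
    refine Finset.disjoint_filter.2 ?_
    rintro j - ⟨-, i, hi⟩ ⟨-, i', hi'⟩
    exact (hdisj i i').le_bot ⟨hi, hi'⟩
  have hgrid := (hX.nat hτ).indepFun_finset A B hAB fun i => (hmeas _).sub (hmeas _)
  rw [IndepFun_iff_Indep] at hgrid ⊢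
  refine indep_of_indep_of_le_left (indep_of_indep_of_le_right hgrid ?_) ?_ <;>
    refine Measurable.comap_le (@measurable_pi_lambda _ _ _ (_) _ _ fun i => ?_)
  · obtain ⟨a, -, ha⟩ := hn (u' i) (by grind)
    obtain ⟨b, hbn, hb⟩ := hn (v' i) (by grind)
    rw [← ha, ← hb]
    refine measurable_comap_grid_increments X hτ (fun j haj hjb hj => ?_) (by grind)
    exact Finset.mem_filter.2 ⟨by grind, hj, i, ha ▸ (hτ haj).trans_lt hj, hb ▸ hτ hjb⟩
  · obtain ⟨a, -, ha⟩ := hn (u i) (by grind)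
    obtain ⟨b, hbn, hb⟩ := hn (v i) (by grind)
    rw [← ha, ← hb]
    refine measurable_comap_grid_increments X hτ (fun j haj hjb hj => ?_) (by grind)
    exact Finset.mem_filter.2 ⟨by grind, hj, i, ha ▸ (hτ haj).trans_lt hj, hb ▸ hτ hjb⟩

end IndependentIncrements

theorem map_withDensity_comp {α β : Type*} [MeasurableSpace α] [MeasurableSpace β] {μ : Measure α}
    {f : α → β} (hf : Measurable f) {g : β → ℝ≥0∞} (hg : Measurable g) :
    (μ.withDensity fun a => g (f a)).map f = (μ.map f).withDensity g := by
  refine Measure.ext fun B hB => ?_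
  rw [Measure.map_apply hf hB, withDensity_apply _ hB, withDensity_apply _ (hf hB),
    setLIntegral_map hB hg hf]

theorem lintegral_comp_const_mul {a : ℝ} (ha : 0 < a) {F : ℝ → ℝ≥0∞} (hF : Measurable F) :
    ∫⁻ x, F (a * x) = ENNReal.ofReal a⁻¹ * ∫⁻ x, F x := by
  rw [← lintegral_map hF (by fun_prop), Real.map_volume_mul_left ha.ne', lintegral_smul_measure,
    abs_of_pos (inv_pos.2 ha), smul_eq_mul]

theorem map_const_mul_withDensity {a : ℝ} (ha : 0 < a) {f : ℝ → ℝ≥0∞} (hf : Measurable f) :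
    (volume.withDensity f).map (a * ·) =
      volume.withDensity fun x => ENNReal.ofReal a⁻¹ * f (a⁻¹ * x) := by
  refine Measure.ext_of_lintegral _ fun F hF => ?_
  have hscaled : Measurable fun x => ENNReal.ofReal a⁻¹ * f (a⁻¹ * x) := by fun_prop
  rw [lintegral_map hF (by fun_prop), lintegral_withDensity_eq_lintegral_mul _ hf (by fun_prop),
    lintegral_withDensity_eq_lintegral_mul _ hscaled hF]
  have hchange := lintegral_comp_const_mul ha (F := fun x => f (a⁻¹ * x) * F x) (by fun_prop)
  simp only [inv_mul_cancel_left₀ ha.ne'] at hchange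
  simp only [Pi.mul_apply, hchange, mul_assoc]
  rw [lintegral_const_mul _ (by fun_prop)]

theorem stableHalfDensity_nonneg {c t : ℝ} (hc : 0 ≤ c) (ht : 0 ≤ t) (x : ℝ) :
    0 ≤ stableHalfDensity c t x := by
  unfold stableHalfDensity
  split_ifs <;> positivity

theorem stableHalfDensity_pos {c t x : ℝ} (hc : 0 < c) (ht : 0 < t) (hx : 0 < x) :
    0 < stableHalfDensity c t x := by
  unfold stableHalfDensity
  rw [if_pos hx]
  positivity

theorem stableHalfDensity_of_nonpos {c t x : ℝ} (hx : x ≤ 0) : stableHalfDensity c t x = 0 :=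
  if_neg hx.not_gt

@[fun_prop]
theorem measurable_stableHalfDensity (c t : ℝ) : Measurable (stableHalfDensity c t) := by
  unfold stableHalfDensity
  exact Measurable.ite measurableSet_Ioi (by fun_prop) measurable_const

theorem stableHalfDensity_scale {a : ℝ} (ha : 0 < a) (c l t x : ℝ) :
    stableHalfDensity (a * (c * l)) t (a ^ 2 * x) =
      (a ^ 2)⁻¹ * stableHalfDensity c (l * t) x := by
  rcases le_or_gt x 0 with hx | hx
  · rw [stableHalfDensity_of_nonpos hx,
      stableHalfDensity_of_nonpos (mul_nonpos_of_nonneg_of_nonpos (sq_nonneg a) hx), mul_zero]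
  have hpow : (a ^ 2 * x) ^ (3 / 2 : ℝ) = a ^ 3 * x ^ (3 / 2 : ℝ) := by
    rw [Real.mul_rpow (sq_nonneg a) hx.le, ← Real.rpow_natCast, ← Real.rpow_mul ha.le,
      ← Real.rpow_natCast a 3]
    norm_num
  have hexponent : (a * (c * l)) ^ 2 * t ^ 2 / (a ^ 2 * x) = c ^ 2 * (l * t) ^ 2 / x := by
    field_simp
  have hx' : x ^ (3 / 2 : ℝ) ≠ 0 := by positivity
  have hpi : √(2 * Real.pi) ≠ 0 := by positivity
  unfold stableHalfDensity
  rw [if_pos hx, if_pos (by positivity), hpow, hexponent]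
  field_simp

namespace IsStableHalfSubordinator

variable {Ω : Type*} [MeasurableSpace Ω] {c : ℝ} {S : ℝ≥0 → Ω → ℝ} {P : Measure Ω}

theorem measurable_sub (hS : IsStableHalfSubordinator c S P) (s t : ℝ≥0) :
    Measurable fun ω => S t ω - S s ω :=
  (hS.measurable t).sub (hS.measurable s)

theorem isProbabilityMeasure_map [IsProbabilityMeasure P] (hS : IsStableHalfSubordinator c S P)
    (t : ℝ≥0) : IsProbabilityMeasure (P.map (S t)) :=
  Measure.isProbabilityMeasure_map (hS.measurable t).aemeasurable

theorem map_eq_withDensity (hS : IsStableHalfSubordinator c S P) {t : ℝ≥0} (ht : 0 < t) :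
    P.map (S t) = volume.withDensity fun x => ENNReal.ofReal (stableHalfDensity c t x) := by
  simpa [hS.start] using hS.law 0 t ht

theorem map_add_sub (hS : IsStableHalfSubordinator c S P) (s t : ℝ≥0) :
    P.map (fun ω => S (s + t) ω - S s ω) = P.map (S t) := by
  rcases eq_zero_or_pos t with rfl | ht
  · simp [funext hS.start]
  · rw [hS.law s (s + t) (lt_add_of_pos_right s ht), hS.map_eq_withDensity ht, NNReal.coe_add,
      add_sub_cancel_left]

theorem map_add [IsProbabilityMeasure P] (hS : IsStableHalfSubordinator c S P) (s t : ℝ≥0) :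
    P.map (S (s + t)) = P.map (S s) ∗ P.map (S t) := by
  have hindep : IndepFun (S s) (S (s + t) - S s) P :=
    hS.indep.indepFun_eval_sub bot_le le_self_add (ae_of_all _ hS.start)
  rw [← hS.map_add_sub s t]
  convert hindep.map_add_eq_map_conv_map (hS.measurable s) (hS.measurable_sub s (s + t))
  exact (add_sub_cancel _ _).symm

theorem lintegral_comp_const_add (hS : IsStableHalfSubordinator c S P) {s : ℝ≥0}
    (hs : 0 < s) {h : ℝ → ℝ≥0∞} (hh : Measurable h) (y : ℝ) :
    ∫⁻ w, h (y + w) ∂(P.map (S s)) =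
      ∫⁻ z, ENNReal.ofReal (stableHalfDensity c s (z - y)) * h z := by
  have htranslate := lintegral_sub_right_eq_self (μ := volume)
    (fun w => ENNReal.ofReal (stableHalfDensity c s w) * h (y + w)) y
  simp only [add_sub_cancel] at htranslate
  rw [htranslate, hS.map_eq_withDensity hs]
  exact lintegral_withDensity_eq_lintegral_mul _ (by fun_prop) (by fun_prop)

theorem shift_scale (hS : IsStableHalfSubordinator c S P) (r : ℝ≥0) {l : ℝ≥0} (hl : 0 < l) {a : ℝ}
    (ha : 0 < a) :
    IsStableHalfSubordinator (a * (c * l)) (fun t ω => a ^ 2 * (S (r + l * t) ω - S r ω)) P where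
  measurable t := (hS.measurable_sub r (r + l * t)).const_mul _
  start ω := by simp
  mono ω s t hst := by
    have hmono : S (r + l * s) ω ≤ S (r + l * t) ω := hS.mono ω (by gcongr)
    exact mul_le_mul_of_nonneg_left (sub_le_sub_right hmono _) (sq_nonneg a)
  rightCts ω t := by
    have hmaps : MapsTo (fun s : ℝ≥0 => r + l * s) (Ici t) (Ici (r + l * t)) := fun s hs =>
      add_le_add_right (mul_le_mul_right (mem_Ici.1 hs) l) r
    have hcomp : ContinuousWithinAt (fun s : ℝ≥0 => S (r + l * s) ω) (Ici t) t :=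
      (hS.rightCts ω (r + l * t)).comp (f := fun s : ℝ≥0 => r + l * s)
        (Continuous.continuousWithinAt (by fun_prop)) hmaps
    exact (hcomp.sub continuousWithinAt_const).const_smul (a ^ 2)
  indep := by
    have htime : HasIndepIncrements (fun t => S (r + l * t)) P := fun n t ht =>
      hS.indep n (fun i => r + l * t i) fun i j hij =>
        add_le_add_right (mul_le_mul_right (ht hij) l) r
    intro n t ht
    convert! (htime n t ht).comp (fun _ x => a ^ 2 * x) (fun _ => by fun_prop) using 3
    simp only [Function.comp_apply]
    ring
  law s t hst := by
    have hfactor :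
        (fun ω => a ^ 2 * (S (r + l * t) ω - S r ω) - a ^ 2 * (S (r + l * s) ω - S r ω)) =
          (a ^ 2 * ·) ∘ fun ω => S (r + l * t) ω - S (r + l * s) ω := by
      funext ω
      simp only [Function.comp_apply]
      ring
    have hdensity (x : ℝ) : stableHalfDensity (a * (c * l)) (t - s) x =
        (a ^ 2)⁻¹ * stableHalfDensity c (l * (t - s)) ((a ^ 2)⁻¹ * x) := by
      rw [← stableHalfDensity_scale ha, mul_inv_cancel_left₀ (by positivity)]
    have hlength : ((r + l * t : ℝ≥0) : ℝ) - (r + l * s : ℝ≥0) = l * (t - s) := by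
      push_cast
      ring
    rw [hfactor, ← Measure.map_map (by fun_prop) (hS.measurable_sub _ _),
      hS.law _ _ (by gcongr), map_const_mul_withDensity (by positivity) (by fun_prop), hlength]
    simp only [hdensity, ENNReal.ofReal_mul (inv_nonneg.2 (sq_nonneg a))]

end IsStableHalfSubordinator

section Tilting

variable {Ω Ω' α β : Type*} [MeasurableSpace Ω] [MeasurableSpace Ω'] [MeasurableSpace α]
  [MeasurableSpace β]

theorem withDensity_compProd {μ : Measure α} [SFinite μ] (κ : Kernel α β) [IsSFiniteKernel κ]
    {g : α → ℝ≥0∞} (hg : Measurable g) :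
    (μ.withDensity g) ⊗ₘ κ = (μ ⊗ₘ κ).withDensity fun q => g q.1 := by
  refine Measure.ext_of_lintegral _ fun F hF => ?_
  have hinner : Measurable fun a => ∫⁻ b, F (a, b) ∂κ a := hF.lintegral_kernel_prod_right'
  rw [Measure.lintegral_compProd hF, lintegral_withDensity_eq_lintegral_mul _ hg hinner,
    lintegral_withDensity_eq_lintegral_mul _ (by fun_prop) hF,
    Measure.lintegral_compProd (by fun_prop)]
  refine lintegral_congr fun a => ?_
  simp only [Pi.mul_apply]
  rw [lintegral_const_mul _ (by fun_prop)]

theorem map_fst_prod_withDensity {μ : Measure α} [SFinite μ] {ν : Measure β} [SFinite ν]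
    {H : α × β → ℝ≥0∞} (hH : Measurable H) :
    ((μ.prod ν).withDensity H).map Prod.fst = μ.withDensity fun x => ∫⁻ y, H (x, y) ∂ν := by
  refine Measure.ext_of_lintegral _ fun F hF => ?_
  rw [lintegral_map hF measurable_fst, lintegral_withDensity_eq_lintegral_mul _ hH (by fun_prop),
    lintegral_withDensity_eq_lintegral_mul _ hH.lintegral_prod_right' hF,
    lintegral_prod _ (by fun_prop)]
  refine lintegral_congr fun x => ?_
  simp only [Pi.mul_apply]
  rw [lintegral_mul_const _ (by fun_prop)]

theorem measure_pi_ext_of_rat_boxes {ι : Type*} [Finite ι] {μ ν : Measure (ι → ℝ)}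
    [IsProbabilityMeasure μ] [IsProbabilityMeasure ν]
    (h : ∀ x : ι → ℚ, μ {y | ∀ i, y i ≤ x i} = ν {y | ∀ i, y i ≤ x i}) : μ = ν := by
  have hspanning (_ : ι) : IsCountablySpanning (⋃ a : ℚ, {Iic (a : ℝ)}) := by
    refine ⟨fun k : ℕ => Iic ((k : ℚ) : ℝ), fun k => mem_iUnion.2 ⟨k, rfl⟩, ?_⟩
    refine eq_univ_iff_forall.2 fun x => ?_
    obtain ⟨k, hk⟩ := exists_nat_ge x
    exact mem_iUnion.2 ⟨k, by simpa using hk⟩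
  have hgenerate : (MeasurableSpace.pi : MeasurableSpace (ι → ℝ)) =
      MeasurableSpace.generateFrom
        (pi univ '' pi univ fun _ : ι => ⋃ a : ℚ, {Iic (a : ℝ)}) := by
    rw [← generateFrom_pi_eq hspanning, ← Real.borel_eq_generateFrom_Iic_rat,
      ← BorelSpace.measurable_eq (α := ℝ)]
  refine ext_of_generate_finite _ hgenerate (IsPiSystem.pi fun _ => Real.isPiSystem_Iic_rat) ?_
    (by simp)
  rintro _ ⟨s, hs, rfl⟩
  simp only [mem_univ_pi, mem_iUnion, mem_singleton_iff] at hs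
  choose x hx using hs
  have hbox : pi univ s = {y | ∀ i, y i ≤ (x i : ℝ)} := by
    ext y
    simp [hx]
  rw [hbox, h x]

variable {P : Measure Ω} [IsProbabilityMeasure P] {P' : Measure Ω'} [IsProbabilityMeasure P']
  {X : Ω → α} {X' : Ω' → α} {g : α → ℝ≥0∞}

theorem condDistrib_ae_eq_of_map_prodMk_eq_withDensity [StandardBorelSpace β] [Nonempty β]
    {Y : Ω → β} {Y' : Ω' → β} (hX : Measurable X) (hY : Measurable Y) (hX' : Measurable X')
    (hY' : Measurable Y') (hg : Measurable g)
    (h : P.map (fun ω => (X ω, Y ω)) = (P'.map fun ω => (X' ω, Y' ω)).withDensity fun q => g q.1) :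
    ∀ᵐ z ∂(P.map X), condDistrib Y X P z = condDistrib Y' X' P' z := by
  have hmarginal : P.map X = (P'.map X').withDensity g := by
    have hfst := congrArg (Measure.map Prod.fst) h
    rwa [map_withDensity_comp measurable_fst hg, Measure.map_map measurable_fst (hX.prodMk hY),
      Measure.map_map measurable_fst (hX'.prodMk hY')] at hfst
  refine condDistrib_ae_eq_of_measure_eq_compProd X hY.aemeasurable ?_
  rw [h, hmarginal, withDensity_compProd _ hg, compProd_map_condDistrib hY'.aemeasurable]

theorem map_prodMk_eq_withDensity_of_condDistrib_boxes_ae_eq {ι : Type*} [Finite ι]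
    {Y : Ω → ι → ℝ} {Y' : Ω' → ι → ℝ} (hY : Measurable Y) (hY' : Measurable Y')
    (hg : Measurable g) (hmarginal : P.map X = (P'.map X').withDensity g)
    (h : ∀ x : ι → ℝ, ∀ᵐ z ∂(P.map X), condDistrib Y X P z {y | ∀ i, y i ≤ x i} =
      condDistrib Y' X' P' z {y | ∀ i, y i ≤ x i}) :
    P.map (fun ω => (X ω, Y ω)) =
      (P'.map fun ω => (X' ω, Y' ω)).withDensity fun q => g q.1 := by
  have hcond : ∀ᵐ z ∂(P.map X), condDistrib Y X P z = condDistrib Y' X' P' z := by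
    filter_upwards [ae_all_iff.2 fun x : ι → ℚ => h fun i => x i] with z hz
    exact measure_pi_ext_of_rat_boxes hz
  rw [← compProd_map_condDistrib hY.aemeasurable, Measure.compProd_congr hcond, hmarginal,
    withDensity_compProd _ hg, compProd_map_condDistrib hY'.aemeasurable]

end Tilting

section PathLaw

variable {Ω Ω' : Type*}

/-- The path of the process `X` stopped at time `T`, as a function on `[0, ∞)`. It determines `X`
on `[0, T]`, and its value at `T` is the terminal value. -/
def pathUpTo (T : ℝ≥0) (X : ℝ≥0 → Ω → ℝ) (ω : Ω) (t : ℝ≥0) : ℝ :=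
  X (min t T) ω

theorem pathUpTo_apply_of_le {T t : ℝ≥0} (ht : t ≤ T) (X : ℝ≥0 → Ω → ℝ) (ω : Ω) :
    pathUpTo T X ω t = X t ω := by
  rw [pathUpTo, min_eq_left ht]

variable [MeasurableSpace Ω] [MeasurableSpace Ω']

theorem measurable_pathUpTo {T : ℝ≥0} {X : ℝ≥0 → Ω → ℝ} (hX : ∀ t ≤ T, Measurable (X t)) :
    Measurable (pathUpTo T X) :=
  measurable_pi_lambda _ fun t => hX _ (min_le_right t T)

/-- The process `X` under `P` has on `[0, T]` the path law of the process `S` under `P'`,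
reweighted by the function `g` of the terminal value. A random bridge is such a process, with `S` a
subordinator and `g` the likelihood ratio of the two terminal laws. -/
structure HasTiltedPathLaw (T : ℝ≥0) (g : ℝ → ℝ≥0∞) (X : ℝ≥0 → Ω → ℝ) (P : Measure Ω)
    (S : ℝ≥0 → Ω' → ℝ) (P' : Measure Ω') : Prop where
  measurable_process : ∀ t ≤ T, Measurable (X t)
  measurable_reference : ∀ t ≤ T, Measurable (S t)
  measurable_weight : Measurable g
  map_eq : P.map (pathUpTo T X) = (P'.map (pathUpTo T S)).withDensity fun x => g (x T)

variable {T : ℝ≥0} {g : ℝ → ℝ≥0∞} {X : ℝ≥0 → Ω → ℝ} {P : Measure Ω} {S : ℝ≥0 → Ω' → ℝ}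
  {P' : Measure Ω'}

theorem HasTiltedPathLaw.map_comp {α : Type*} [MeasurableSpace α]
    (h : HasTiltedPathLaw T g X P S P') {R : (ℝ≥0 → ℝ) → α} (hR : Measurable R) {e : α → ℝ}
    (he : Measurable e) (hRe : ∀ x, e (R x) = x T) :
    P.map (fun ω => R (pathUpTo T X ω)) =
      (P'.map fun ω => R (pathUpTo T S ω)).withDensity fun a => g (e a) := by
  have hcomp := congrArg (Measure.map R) h.map_eq
  simp only [← hRe] at hcomp
  rwa [map_withDensity_comp (g := fun a => g (e a)) hR (h.measurable_weight.comp he),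
    Measure.map_map hR (measurable_pathUpTo h.measurable_process),
    Measure.map_map hR (measurable_pathUpTo h.measurable_reference)] at hcomp

theorem HasTiltedPathLaw.map_terminal (h : HasTiltedPathLaw T g X P S P') :
    P.map (X T) = (P'.map (S T)).withDensity g := by
  simpa [pathUpTo] using h.map_comp (measurable_pi_apply T) measurable_id fun _ => rfl

theorem HasTiltedPathLaw.map_prodMk_of_indepFun [IsProbabilityMeasure P'] {α β : Type*}
    [MeasurableSpace α] [MeasurableSpace β] (h : HasTiltedPathLaw T g X P S P')
    {A : (ℝ≥0 → ℝ) → α} (hA : Measurable A) {B : (ℝ≥0 → ℝ) → β} (hB : Measurable B)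
    {e : α × β → ℝ} (he : Measurable e) (hABe : ∀ x, e (A x, B x) = x T)
    (hindep : IndepFun (fun ω => A (pathUpTo T S ω)) (fun ω => B (pathUpTo T S ω)) P') :
    P.map (fun ω => (A (pathUpTo T X ω), B (pathUpTo T X ω))) =
      ((P'.map fun ω => A (pathUpTo T S ω)).prod
        (P'.map fun ω => B (pathUpTo T S ω))).withDensity fun q => g (e q) := by
  have hpath := measurable_pathUpTo h.measurable_reference
  have hA' : Measurable fun ω => A (pathUpTo T S ω) := hA.comp hpath
  have hB' : Measurable fun ω => B (pathUpTo T S ω) := hB.comp hpath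
  rw [h.map_comp (hA.prodMk hB) he hABe,
    (indepFun_iff_map_prod_eq_prod_map_map hA'.aemeasurable hB'.aemeasurable).1 hindep]

theorem HasTiltedPathLaw.map_of_indepFun [IsProbabilityMeasure P'] {α β : Type*}
    [MeasurableSpace α] [MeasurableSpace β] (h : HasTiltedPathLaw T g X P S P')
    {A : (ℝ≥0 → ℝ) → α} (hA : Measurable A) {B : (ℝ≥0 → ℝ) → β} (hB : Measurable B)
    {e : α × β → ℝ} (he : Measurable e) (hABe : ∀ x, e (A x, B x) = x T)
    (hindep : IndepFun (fun ω => A (pathUpTo T S ω)) (fun ω => B (pathUpTo T S ω)) P') :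
    P.map (fun ω => A (pathUpTo T X ω)) =
      (P'.map fun ω => A (pathUpTo T S ω)).withDensity fun x =>
        ∫⁻ y, g (e (x, y)) ∂(P'.map fun ω => B (pathUpTo T S ω)) := by
  have hB' : Measurable fun ω => B (pathUpTo T X ω) :=
    hB.comp (measurable_pathUpTo h.measurable_process)
  rw [← map_fst_prod_withDensity (H := fun q => g (e q)) (h.measurable_weight.comp he)]
  exact (Measure.fst_map_prodMk hB').symm.trans
    (congrArg (Measure.map Prod.fst) (h.map_prodMk_of_indepFun hA hB he hABe hindep))

theorem HasTiltedPathLaw.congr (h : HasTiltedPathLaw T g X P S P') {Y : ℝ≥0 → Ω → ℝ}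
    (hY : ∀ t ≤ T, Measurable (Y t)) (hXY : ∀ᵐ ω ∂P, ∀ t ≤ T, Y t ω = X t ω) :
    HasTiltedPathLaw T g Y P S P' where
  measurable_process := hY
  measurable_reference := h.measurable_reference
  measurable_weight := h.measurable_weight
  map_eq := by
    rw [← h.map_eq]
    exact Measure.map_congr (hXY.mono fun ω hω => funext fun t => hω _ (min_le_right t T))

theorem exists_measurable_restrict_stopped_eq (I : Finset ℝ≥0) (T : ℝ≥0) :
    ∃ Φ : ℝ × (I.filter (· ∈ Ioo 0 T) → ℝ) → I → ℝ, Measurable Φ ∧ ∀ x : ℝ≥0 → ℝ, x 0 = 0 →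
      I.restrict (fun t => x (min t T)) = Φ (x T, fun j => x j) := by
  classical
  refine ⟨fun q i => if h : (i : ℝ≥0) ∈ I.filter (· ∈ Ioo 0 T) then q.2 ⟨i, h⟩
    else if (i : ℝ≥0) = 0 then 0 else q.1, ?_, fun x hx => ?_⟩
  · refine measurable_pi_lambda _ fun i => ?_
    split_ifs <;> fun_prop
  · funext i
    simp only [Finset.restrict]
    split_ifs with hi h0
    · rw [min_eq_left (Finset.mem_filter.1 hi).2.2.le]
    · rw [h0, min_eq_left (zero_le (a := T)), hx]
    · have hTi : T ≤ i := by
        by_contra! hlt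
        exact hi (Finset.mem_filter.2 ⟨i.2, pos_iff_ne_zero.2 h0, hlt⟩)
      rw [min_eq_right hTi]

theorem map_finset_eq_of_map_strictMono_eq {Q : Measure Ω'} (hX : ∀ t ≤ T, Measurable (X t))
    (hS : ∀ t ≤ T, Measurable (S t))
    (h : ∀ (n : ℕ) (t : Fin n → ℝ≥0), StrictMono t → (∀ i, t i ∈ Ioo 0 T) →
      P.map (fun ω => (X T ω, fun i => X (t i) ω)) =
        Q.map fun ω => (S T ω, fun i => S (t i) ω))
    {J : Finset ℝ≥0} (hJ : ∀ j ∈ J, j ∈ Ioo 0 T) :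
    P.map (fun ω => (X T ω, fun j : J => X j ω)) =
      Q.map fun ω => (S T ω, fun j : J => S j ω) := by
  let e := J.orderIsoOfFin rfl
  have he (i) : (e i : ℝ≥0) ∈ Ioo 0 T := hJ _ (e i).2
  have hreindex : Measurable fun q : ℝ × (Fin J.card → ℝ) => (q.1, fun j => q.2 (e.symm j)) := by
    fun_prop
  have hmap := congrArg (Measure.map fun q : ℝ × (Fin J.card → ℝ) => (q.1, fun j => q.2 (e.symm j)))
    (h _ (fun i => e i) e.strictMono he)
  rw [Measure.map_map hreindex ((hX T le_rfl).prodMk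
      (measurable_pi_lambda _ fun i => hX _ (he i).2.le)),
    Measure.map_map hreindex ((hS T le_rfl).prodMk
      (measurable_pi_lambda _ fun i => hS _ (he i).2.le))] at hmap
  simpa [Function.comp_def] using hmap

theorem map_pathUpTo_eq_of_map_strictMono_eq [IsFiniteMeasure P] {Q : Measure Ω'}
    (hX : ∀ t ≤ T, Measurable (X t)) (hS : ∀ t ≤ T, Measurable (S t))
    (hX0 : ∀ᵐ ω ∂P, X 0 ω = 0) (hS0 : ∀ᵐ ω ∂Q, S 0 ω = 0)
    (h : ∀ (n : ℕ) (t : Fin n → ℝ≥0), StrictMono t → (∀ i, t i ∈ Ioo 0 T) →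
      P.map (fun ω => (X T ω, fun i => X (t i) ω)) =
        Q.map fun ω => (S T ω, fun i => S (t i) ω)) :
    P.map (pathUpTo T X) = Q.map (pathUpTo T S) := by
  classical
  refine IsProjectiveLimit.unique (P := fun I => (P.map (pathUpTo T X)).map I.restrict)
    (fun _ => rfl) fun I => ?_
  have hJ : ∀ j ∈ I.filter (· ∈ Ioo 0 T), j ∈ Ioo 0 T := fun j hj => (Finset.mem_filter.1 hj).2
  obtain ⟨Φ, hΦ, hΦ_eq⟩ := exists_measurable_restrict_stopped_eq I T
  have hrestrict : Measurable (I.restrict (π := fun _ => ℝ)) := by fun_prop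
  have hX_joint : Measurable fun ω => (X T ω, fun j : I.filter (· ∈ Ioo 0 T) => X j ω) :=
    (hX T le_rfl).prodMk (measurable_pi_lambda _ fun j => hX _ (hJ j j.2).2.le)
  have hS_joint : Measurable fun ω => (S T ω, fun j : I.filter (· ∈ Ioo 0 T) => S j ω) :=
    (hS T le_rfl).prodMk (measurable_pi_lambda _ fun j => hS _ (hJ j j.2).2.le)
  calc (Q.map (pathUpTo T S)).map I.restrict
      = Q.map fun ω => Φ (S T ω, fun j => S j ω) := by
        rw [Measure.map_map hrestrict (measurable_pathUpTo hS)]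
        exact Measure.map_congr (hS0.mono fun ω => hΦ_eq fun t => S t ω)
    _ = P.map fun ω => Φ (X T ω, fun j => X j ω) := by
        have hmap := congrArg (Measure.map Φ) (map_finset_eq_of_map_strictMono_eq hX hS h hJ)
        rw [Measure.map_map hΦ hX_joint, Measure.map_map hΦ hS_joint] at hmap
        exact hmap.symm
    _ = (P.map (pathUpTo T X)).map I.restrict := by
        rw [Measure.map_map hrestrict (measurable_pathUpTo hX)]
        exact (Measure.map_congr (hX0.mono fun ω => hΦ_eq fun t => X t ω)).symm

theorem hasTiltedPathLaw_of_marginals [IsFiniteMeasure P]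
    (hX : ∀ t ≤ T, Measurable (X t)) (hS : ∀ t ≤ T, Measurable (S t)) (hg : Measurable g)
    (hX0 : ∀ᵐ ω ∂P, X 0 ω = 0) (hS0 : ∀ᵐ ω ∂P', S 0 ω = 0)
    (h : ∀ (n : ℕ) (t : Fin n → ℝ≥0), StrictMono t → (∀ i, t i ∈ Ioo 0 T) →
      P.map (fun ω => (X T ω, fun i => X (t i) ω)) =
        (P'.map fun ω => (S T ω, fun i => S (t i) ω)).withDensity fun q => g q.1) :
    HasTiltedPathLaw T g X P S P' where
  measurable_process := hX
  measurable_reference := hS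
  measurable_weight := hg
  map_eq := by
    have hterminal (ω : Ω') : S T ω = pathUpTo T S ω T :=
      (pathUpTo_apply_of_le le_rfl S ω).symm
    rw [map_pathUpTo_eq_of_map_strictMono_eq (Q := P'.withDensity fun ω => g (S T ω)) hX hS hX0
      (withDensity_absolutelyContinuous _ _ hS0) fun n t ht htT => ?_]
    · simp only [hterminal]
      exact map_withDensity_comp (g := fun x => g (x T)) (measurable_pathUpTo hS) (by fun_prop)
    · have hjoint : Measurable fun ω => (S T ω, fun i => S (t i) ω) :=
        (hS T le_rfl).prodMk (measurable_pi_lambda _ fun i => hS _ (htT i).2.le)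
      rw [h n t ht htT, ← map_withDensity_comp (g := fun q => g q.1) hjoint (by fun_prop)]

end PathLaw

/-- The likelihood ratio, on `(0, ∞)`, of the terminal density `p` of a random bridge and the
density of the subordinator at the terminal time `T`. -/
noncomputable def bridgeWeight (c T : ℝ) (p : ℝ → ℝ) (z : ℝ) : ℝ≥0∞ :=
  ENNReal.ofReal (p z / stableHalfDensity c T z)

@[fun_prop]
theorem measurable_bridgeWeight (c T : ℝ) {p : ℝ → ℝ} (hp : Measurable p) :
    Measurable (bridgeWeight c T p) :=
  ENNReal.measurable_ofReal.comp (hp.div (measurable_stableHalfDensity c T))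

theorem bridgeWeight_of_nonpos {c T z : ℝ} {p : ℝ → ℝ} (hz : z ≤ 0) : bridgeWeight c T p z = 0 := by
  simp [bridgeWeight, stableHalfDensity_of_nonpos hz]

theorem ofReal_stableHalfDensity_mul_bridgeWeight {c T : ℝ} (hc : 0 < c) (hT : 0 < T) (p : ℝ → ℝ)
    {z : ℝ} (hz : 0 < z) :
    ENNReal.ofReal (stableHalfDensity c T z) * bridgeWeight c T p z = ENNReal.ofReal (p z) := by
  have hdensity := stableHalfDensity_pos hc hT hz
  rw [bridgeWeight, ← ENNReal.ofReal_mul hdensity.le, mul_div_cancel₀ _ hdensity.ne']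

theorem measurable_stableHalfBridgeDensity (c t T : ℝ) :
    Measurable (Function.uncurry (stableHalfBridgeDensity c t T)) := by
  unfold stableHalfBridgeDensity Function.uncurry
  fun_prop

theorem stableHalfBridgeDensity_nonneg {c t T : ℝ} (hc : 0 ≤ c) (ht : 0 ≤ t) (htT : t ≤ T)
    (y z : ℝ) : 0 ≤ stableHalfBridgeDensity c t T y z :=
  div_nonneg (mul_nonneg (stableHalfDensity_nonneg hc ht _)
    (stableHalfDensity_nonneg hc (sub_nonneg.2 htT) _))
    (stableHalfDensity_nonneg hc (ht.trans htT) _)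

theorem IsStableHalfSubordinator.lawOfDensity_eq {Ω : Type*} [MeasurableSpace Ω] {c : ℝ}
    {S : ℝ≥0 → Ω → ℝ} {P : Measure Ω} (hS : IsStableHalfSubordinator c S P) (hc : 0 < c) {T : ℝ≥0}
    (hT : 0 < T) {p : ℝ → ℝ} (hp : Measurable p) :
    lawOfDensity p = (P.map (S T)).withDensity (bridgeWeight c T p) := by
  rw [hS.map_eq_withDensity hT, ← withDensity_mul _ (by fun_prop) (by fun_prop), lawOfDensity,
    ← withDensity_indicator measurableSet_Ioi]
  refine congrArg _ (funext fun z => ?_)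
  rw [Pi.mul_apply]
  rcases le_or_gt z 0 with hz | hz
  · rw [indicator_of_notMem (by simpa using hz), bridgeWeight_of_nonpos hz, mul_zero]
  · rw [indicator_of_mem (by simpa using hz),
      ofReal_stableHalfDensity_mul_bridgeWeight hc (by exact_mod_cast hT) p hz]

theorem lawOfDensity_integral_eq {G : ℝ → ℝ → ℝ} (hG : Measurable (Function.uncurry G))
    (hG_nonneg : ∀ y z, 0 < z → 0 ≤ G y z) {f g : ℝ → ℝ≥0∞} (hf : Measurable f)
    (hf_nonpos : ∀ y ≤ 0, f y = 0) (hg : Measurable g)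
    (hfinite : ∫⁻ y, g y ∂(volume.withDensity f) ≠ ∞)
    (hfg : ∀ y, 0 < y → f y * g y = ∫⁻ z in Ioi 0, ENNReal.ofReal (G y z)) :
    lawOfDensity (fun y => ∫ z in Ioi 0, G y z) = (volume.withDensity f).withDensity g := by
  rw [lintegral_withDensity_eq_lintegral_mul _ hf hg] at hfinite
  rw [← withDensity_mul _ hf hg, lawOfDensity, ← withDensity_indicator measurableSet_Ioi]
  refine withDensity_congr_ae ?_
  filter_upwards [ae_lt_top (hf.mul hg) hfinite] with y hy
  rw [Pi.mul_apply] at hy ⊢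
  rcases le_or_gt y 0 with hy0 | hy0
  · rw [indicator_of_notMem (by simpa using hy0), hf_nonpos y hy0, zero_mul]
  rw [indicator_of_mem (by simpa using hy0), hfg y hy0]
  rw [hfg y hy0] at hy
  have hnonneg : 0 ≤ᵐ[volume.restrict (Ioi 0)] G y :=
    (ae_restrict_iff' measurableSet_Ioi).2 (ae_of_all _ fun z hz => hG_nonneg y z hz)
  have hmeas : Measurable (G y) := hG.comp measurable_prodMk_left
  refine ofReal_integral_eq_lintegral_ofReal ⟨hmeas.aestronglyMeasurable, ?_⟩ hnonneg
  rwa [hasFiniteIntegral_iff_ofReal hnonneg]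

theorem IsStableHalfRandomBridge.exists_hasTiltedPathLaw {Ω : Type*} [MeasurableSpace Ω]
    {P : Measure Ω} [IsProbabilityMeasure P] {c : ℝ} {T : ℝ≥0} {p : ℝ → ℝ} {ξ : ℝ → Ω → ℝ}
    (hξ : IsStableHalfRandomBridge c T p ξ P) (hc : 0 < c) (hT : 0 < T) :
    ∃ (Ω' : Type) (_ : MeasurableSpace Ω') (P' : Measure Ω') (_ : IsProbabilityMeasure P')
      (S : ℝ≥0 → Ω' → ℝ), IsStableHalfSubordinator c S P' ∧
        HasTiltedPathLaw T (bridgeWeight c T p) (fun t : ℝ≥0 => ξ t) P S P' := by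
  obtain ⟨Ω', _, P', _, S, hS, hbridge⟩ := hξ.bridge_law
  have hmeas (t : ℝ≥0) (ht : t ≤ T) : Measurable (ξ t) :=
    hξ.measurable t ⟨t.coe_nonneg, NNReal.coe_le_coe.2 ht⟩
  have hweight := measurable_bridgeWeight c T hξ.density_measurable
  refine ⟨Ω', _, P', ‹_›, S, hS, hasTiltedPathLaw_of_marginals hmeas (fun t _ => hS.measurable t)
    hweight hξ.start (ae_of_all _ hS.start) fun n t ht htT => ?_⟩
  refine map_prodMk_eq_withDensity_of_condDistrib_boxes_ae_eq
    (measurable_pi_lambda _ fun i => hmeas _ (htT i).2.le)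
    (measurable_pi_lambda _ fun i => hS.measurable _) hweight
    (hξ.terminal_law.trans (hS.lawOfDensity_eq hc hT hξ.density_measurable)) fun x => ?_
  simpa only [hξ.terminal_law, Real.toNNReal_coe] using
    hbridge n (fun i => t i) (fun i j hij => NNReal.coe_lt_coe.2 (ht hij))
      (fun i => ⟨NNReal.coe_pos.2 (htT i).1, NNReal.coe_lt_coe.2 (htT i).2⟩) x

theorem HasTiltedPathLaw.isStableHalfRandomBridge {Ω : Type*} [MeasurableSpace Ω]
    {P : Measure Ω} [IsProbabilityMeasure P] {Ω' : Type} [MeasurableSpace Ω'] {P' : Measure Ω'}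
    [IsProbabilityMeasure P'] {c : ℝ} {T : ℝ≥0} {g : ℝ → ℝ≥0∞} {ξ : ℝ → Ω → ℝ} {S : ℝ≥0 → Ω' → ℝ}
    {q : ℝ → ℝ} (h : HasTiltedPathLaw T g (fun t : ℝ≥0 => ξ t) P S P')
    (hS : IsStableHalfSubordinator c S P') (hq : Measurable q) (hq_nonneg : ∀ z, 0 < z → 0 ≤ q z)
    (hqg : lawOfDensity q = (P'.map (S T)).withDensity g) (hstart : ∀ᵐ ω ∂P, ξ 0 ω = 0)
    (hright : ∀ ω, ∀ t ∈ Ico 0 (T : ℝ), ContinuousWithinAt (fun s => ξ s ω) (Ici t) t)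
    (hleft : ∀ ω, ∀ t ∈ Ioc 0 (T : ℝ), ∃ l : ℝ, Tendsto (fun s => ξ s ω) (𝓝[<] t) (𝓝 l)) :
    IsStableHalfRandomBridge c T q ξ P := by
  have hmeas (t) (ht : t ∈ Icc 0 (T : ℝ)) : Measurable (ξ t) := by
    lift t to ℝ≥0 using ht.1
    exact h.measurable_process t (NNReal.coe_le_coe.1 ht.2)
  have hterminal : P.map (ξ T) = lawOfDensity q := h.map_terminal.trans hqg.symm
  refine ⟨hmeas, hstart, hright, hleft, hq, hq_nonneg, hterminal, Ω', ‹_›, P', ‹_›, S, hS,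
    fun n t _ htT x => ?_⟩
  lift t to Fin n → ℝ≥0 using fun i => (htT i).1.le
  have ht (i) : t i ≤ T := NNReal.coe_le_coe.1 (htT i).2.le
  have hjoint := h.map_comp (R := fun x => (x T, fun i => x (t i))) (by fun_prop) measurable_fst
    fun _ => rfl
  simp only [pathUpTo, min_self, min_eq_left (ht _)] at hjoint
  have hcond := condDistrib_ae_eq_of_map_prodMk_eq_withDensity (h.measurable_process T le_rfl)
    (measurable_pi_lambda _ fun i => h.measurable_process _ (ht i)) (hS.measurable T)
    (measurable_pi_lambda _ fun i => hS.measurable (t i)) h.measurable_weight hjoint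
  rw [hterminal] at hcond
  filter_upwards [hcond] with z hz
  simp only [Real.toNNReal_coe, hz]

theorem stableHalfBridgeDensity_scale {a l : ℝ} (ha : 0 < a) (hl : 0 < l) (c T τ y v : ℝ) :
    stableHalfBridgeDensity (a * (c * l)) T (l⁻¹ * τ) y (a ^ 2 * v) =
      stableHalfDensity (a * (c * l)) T y *
        (stableHalfDensity c (τ - l * T) (v - (a ^ 2)⁻¹ * y) / stableHalfDensity c τ v) := by
  have hspace : a ^ 2 * v - y = a ^ 2 * (v - (a ^ 2)⁻¹ * y) := by field_simp
  have htime : l * (l⁻¹ * τ - T) = τ - l * T := by field_simp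
  rw [stableHalfBridgeDensity, hspace, stableHalfDensity_scale ha, stableHalfDensity_scale ha,
    htime, mul_inv_cancel_left₀ hl.ne', mul_div_assoc, mul_div_mul_left _ _ (by positivity)]

theorem setLIntegral_Ioi_comp_const_mul {a : ℝ} (ha : 0 < a) {F : ℝ → ℝ≥0∞} (hF : Measurable F) :
    ∫⁻ x in Ioi 0, F (a * x) = ENNReal.ofReal a⁻¹ * ∫⁻ x in Ioi 0, F x := by
  rw [← lintegral_indicator measurableSet_Ioi, ← lintegral_indicator measurableSet_Ioi,
    ← lintegral_comp_const_mul ha (hF.indicator measurableSet_Ioi)]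
  refine lintegral_congr fun x => ?_
  simp only [indicator, mem_Ioi, mul_pos_iff_of_pos_left ha]

theorem continuousWithinAt_Ici_of_eq_affine {f g : ℝ → ℝ} {A B l r T t : ℝ} (hl : 0 ≤ l)
    (ht : t ∈ Ico 0 T) (hg : ∀ u ∈ Icc 0 T, g u = A * f (l * u + r) - B)
    (hf : ContinuousWithinAt f (Ici (l * t + r)) (l * t + r)) :
    ContinuousWithinAt g (Ici t) t := by
  have hmaps : MapsTo (fun u => l * u + r) (Ici t) (Ici (l * t + r)) := fun u hu =>
    add_le_add_left (mul_le_mul_of_nonneg_left (mem_Ici.1 hu) hl) r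
  have hcomp : ContinuousWithinAt (fun u => f (l * u + r)) (Ici t) t :=
    hf.comp (f := fun u => l * u + r) (Continuous.continuousWithinAt (by fun_prop)) hmaps
  refine ((hcomp.const_smul A).sub continuousWithinAt_const).congr_of_eventuallyEq ?_
    (hg t ⟨ht.1, ht.2.le⟩)
  filter_upwards [Icc_mem_nhdsGE ht.2] with u hu using hg u ⟨ht.1.trans hu.1, hu.2⟩

theorem exists_tendsto_nhdsLT_of_eq_affine {f g : ℝ → ℝ} {A B l r T t : ℝ} (hl : 0 < l)
    (ht : t ∈ Ioc 0 T) (hg : ∀ u ∈ Icc 0 T, g u = A * f (l * u + r) - B)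
    (hf : ∃ L : ℝ, Tendsto f (𝓝[<] (l * t + r)) (𝓝 L)) :
    ∃ L : ℝ, Tendsto g (𝓝[<] t) (𝓝 L) := by
  obtain ⟨L, hL⟩ := hf
  have haffine : Tendsto (fun u => l * u + r) (𝓝[<] t) (𝓝[<] (l * t + r)) := by
    refine tendsto_nhdsWithin_iff.2 ⟨(Continuous.tendsto (by fun_prop) t).mono_left
      nhdsWithin_le_nhds, ?_⟩
    filter_upwards [self_mem_nhdsWithin] with u hu
    exact add_lt_add_left (mul_lt_mul_of_pos_left (mem_Iio.1 hu) hl) r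
  refine ⟨A * L - B, (((hL.comp haffine).const_mul A).sub_const B).congr' ?_⟩
  filter_upwards [Ico_mem_nhdsLT ht.1] with u hu using (hg u ⟨hu.1, hu.2.le.trans ht.2⟩).symm

section AffineTimeChange

variable {Ω Ω' : Type*} [MeasurableSpace Ω] [MeasurableSpace Ω'] {P : Measure Ω}
  {P' : Measure Ω'} {c a : ℝ} {r l T τ : ℝ≥0} {g : ℝ → ℝ≥0∞}
  {p : ℝ → ℝ} {X : ℝ≥0 → Ω → ℝ} {S : ℝ≥0 → Ω' → ℝ}

theorem IsStableHalfSubordinator.ofReal_mul_lintegral_bridgeWeight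
    (hS : IsStableHalfSubordinator c S P') (hc : 0 < c) (ha : 0 < a) (hl : 0 < l)
    (hlT : l * T < τ) (hp : Measurable p) (y : ℝ) :
    ENNReal.ofReal (stableHalfDensity (a * (c * l)) T y) *
        ∫⁻ w, bridgeWeight c τ p ((a ^ 2)⁻¹ * y + w) ∂(P'.map (S (τ - l * T))) =
      ∫⁻ z in Ioi 0, ENNReal.ofReal ((a ^ 2)⁻¹ *
        (stableHalfBridgeDensity (a * (c * l)) T ((l : ℝ)⁻¹ * τ) y z * p ((a ^ 2)⁻¹ * z))) := by
  have hbridge : Measurable (stableHalfBridgeDensity (a * (c * l)) T ((l : ℝ)⁻¹ * τ) y) :=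
    (measurable_stableHalfBridgeDensity _ _ _).comp measurable_prodMk_left
  simp only [ENNReal.ofReal_mul (inv_nonneg.2 (sq_nonneg a))]
  rw [hS.lintegral_comp_const_add (tsub_pos_of_lt hlT) (measurable_bridgeWeight c τ hp),
    ← lintegral_const_mul _ (by fun_prop),
    lintegral_const_mul (ENNReal.ofReal (a ^ 2)⁻¹) (by fun_prop),
    ← setLIntegral_Ioi_comp_const_mul (by positivity) (by fun_prop),
    ← lintegral_indicator measurableSet_Ioi]
  refine lintegral_congr fun v => ?_
  rcases le_or_gt v 0 with hv | hv
  · rw [indicator_of_notMem (by simpa using hv), bridgeWeight_of_nonpos hv, mul_zero, mul_zero]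
  have htime : (0 : ℝ) ≤ (τ - l * T : ℝ≥0) := NNReal.coe_nonneg _
  rw [indicator_of_mem (by simpa using hv), bridgeWeight,
    ← ENNReal.ofReal_mul (stableHalfDensity_nonneg hc.le htime _),
    ← ENNReal.ofReal_mul (stableHalfDensity_nonneg (by positivity) T.coe_nonneg _),
    stableHalfBridgeDensity_scale ha (by exact_mod_cast hl), NNReal.coe_sub hlT.le, NNReal.coe_mul,
    inv_mul_cancel_left₀ (by positivity)]
  ring_nf

variable [IsProbabilityMeasure P']

theorem IsStableHalfSubordinator.indepFun_sub_sub (hS : IsStableHalfSubordinator c S P')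
    {s t : ℝ≥0} (hrs : r ≤ s) (hst : s ≤ t) (htτ : t ≤ τ) :
    IndepFun (fun ω => S s ω - S r ω) (fun ω => S τ ω - S t ω) P' :=
  (indepFun_increments_of_disjoint hS.measurable hS.indep (u := fun _ : Unit => r) (v := fun _ => s)
    (u' := fun _ : Unit => t) (v' := fun _ => τ) (fun _ => hrs) (fun _ => htτ)
    fun _ _ => Ioc_disjoint_Ioc_of_le hst).comp (measurable_pi_apply ()) (measurable_pi_apply ())

theorem IsStableHalfSubordinator.map_sub_add_sub (hS : IsStableHalfSubordinator c S P') {s t : ℝ≥0}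
    (hrs : r ≤ s) (hst : s ≤ t) (htτ : t ≤ τ) :
    P'.map (fun ω => (S s ω - S r ω) + (S τ ω - S t ω)) = P'.map (S ((s - r) + (τ - t))) := by
  rw [hS.map_add, ← hS.map_add_sub r, ← hS.map_add_sub t, add_tsub_cancel_of_le hrs,
    add_tsub_cancel_of_le htτ]
  exact (hS.indepFun_sub_sub hrs hst htτ).map_add_eq_map_conv_map (hS.measurable_sub r s)
    (hS.measurable_sub t τ)

theorem IsStableHalfSubordinator.map_add_increment (hS : IsStableHalfSubordinator c S P')
    {s : ℝ≥0} (hrs : r ≤ s) (hsτ : s ≤ τ) :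
    P'.map (fun ω => S r ω + (S τ ω - S s ω)) = P'.map (S (r + (τ - s))) := by
  simpa [hS.start] using hS.map_sub_add_sub (zero_le (a := r)) hrs hsτ

theorem IsStableHalfSubordinator.indepFun_affine_increment (hS : IsStableHalfSubordinator c S P')
    (hrT : r + l * T ≤ τ) :
    IndepFun (fun ω (t : ℝ≥0) => S (r + l * min t T) ω - S r ω)
      (fun ω => S r ω + (S τ ω - S (r + l * T) ω)) P' := by
  have hpair := indepFun_increments_of_disjoint hS.measurable hS.indep
    (u := fun _ : ℝ≥0 => r) (v := fun t => r + l * min t T)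
    (u' := fun i : Bool => bif i then r + l * T else 0) (v' := fun i => bif i then τ else r)
    (fun t => le_self_add) (by simpa using hrT) fun t i => ?_
  · have hsum : Measurable fun y : Bool → ℝ => y false + y true := by fun_prop
    simpa [Function.comp_def, hS.start] using! hpair.comp measurable_id hsum
  · cases i
    · exact (Ioc_disjoint_Ioc_of_le le_rfl).symm
    · exact Ioc_disjoint_Ioc_of_le (by simp only [cond_true]; gcongr; exact min_le_right t T)

theorem HasTiltedPathLaw.affine_increment (h : HasTiltedPathLaw τ g X P S P')
    (hS : IsStableHalfSubordinator c S P') (ha : a ≠ 0) (hrT : r + l * T ≤ τ) :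
    HasTiltedPathLaw T (fun x => ∫⁻ w, g ((a ^ 2)⁻¹ * x + w) ∂(P'.map (S (τ - l * T))))
      (fun t ω => a ^ 2 * (X (r + l * t) ω - X r ω)) P
      (fun t ω => a ^ 2 * (S (r + l * t) ω - S r ω)) P' where
  measurable_process t ht := ((h.measurable_process _ (hrT.trans' (by gcongr))).sub
    (h.measurable_process r (le_self_add.trans hrT))).const_mul _
  measurable_reference t _ := (hS.measurable_sub r _).const_mul _
  measurable_weight := by
    have := h.measurable_weight
    exact Measurable.lintegral_prod_right' (f := fun q : ℝ × ℝ => g ((a ^ 2)⁻¹ * q.1 + q.2))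
      (by fun_prop)
  map_eq := by
    have hA : Measurable fun (x : ℝ≥0 → ℝ) (t : ℝ≥0) => a ^ 2 * (x (r + l * min t T) - x r) := by
      fun_prop
    have hB : Measurable fun x : ℝ≥0 → ℝ => x r + (x τ - x (r + l * T)) := by fun_prop
    have hA_scale : Measurable fun (y : ℝ≥0 → ℝ) (t : ℝ≥0) => a ^ 2 * y t := by fun_prop
    have hle (t : ℝ≥0) : min (r + l * min t T) τ = r + l * min t T :=
      min_eq_left (hrT.trans' (by gcongr; exact min_le_right t T))
    have hends : min r τ = r ∧ min (r + l * T) τ = r + l * T :=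
      ⟨min_eq_left (le_self_add.trans hrT), min_eq_left hrT⟩
    have hindep := (hS.indepFun_affine_increment hrT).comp hA_scale measurable_id
    have hlaw := h.map_of_indepFun hA hB (e := fun q => (a ^ 2)⁻¹ * q.1 T + q.2) (by fun_prop)
      (fun x => by
        simp only [min_self, inv_mul_cancel_left₀ (pow_ne_zero 2 ha)]
        abel)
      (by simpa [pathUpTo, hle, hends, Function.comp_def] using! hindep)
    simp only [pathUpTo, hle, hends, min_self, hS.map_add_increment le_self_add hrT] at hlaw
    have htime : r + (τ - (r + l * T)) = τ - l * T := by
      rw [add_comm r, add_comm r, ← tsub_tsub,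
        tsub_add_cancel_of_le (le_tsub_of_add_le_right hrT)]
    rwa [htime] at hlaw

theorem IsStableHalfSubordinator.lawOfDensity_affine_increment_eq
    (hS : IsStableHalfSubordinator c S P') (hc : 0 < c) (ha : 0 < a) (hl : 0 < l) (hT : 0 < T)
    (hlT : l * T < τ) (hp : Measurable p) (hp_nonneg : ∀ z, 0 < z → 0 ≤ p z)
    (hfinite : ∫⁻ y, ∫⁻ w, bridgeWeight c τ p ((a ^ 2)⁻¹ * y + w) ∂(P'.map (S (τ - l * T)))
      ∂(P'.map fun ω => a ^ 2 * (S (r + l * T) ω - S r ω)) ≠ ∞) :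
    lawOfDensity (fun x => ∫ z in Ioi 0, (a ^ 2)⁻¹ *
        (stableHalfBridgeDensity (a * (c * l)) T ((l : ℝ)⁻¹ * τ) x z * p ((a ^ 2)⁻¹ * z))) =
      (P'.map fun ω => a ^ 2 * (S (r + l * T) ω - S r ω)).withDensity fun y =>
        ∫⁻ w, bridgeWeight c τ p ((a ^ 2)⁻¹ * y + w) ∂(P'.map (S (τ - l * T))) := by
  have hTτ : (T : ℝ) ≤ (l : ℝ)⁻¹ * τ := NNReal.coe_le_coe.2 (le_inv_mul_iff₀ hl |>.2 hlT.le)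
  have hweight := measurable_bridgeWeight c τ hp
  have hbridge := measurable_stableHalfBridgeDensity (a * (c * l)) T ((l : ℝ)⁻¹ * τ)
  rw [(hS.shift_scale r hl ha).map_eq_withDensity hT] at hfinite ⊢
  refine lawOfDensity_integral_eq ((hbridge.mul (by fun_prop)).const_mul _) (fun y z hz => ?_)
    (by fun_prop) (fun y hy => by rw [stableHalfDensity_of_nonpos hy, ENNReal.ofReal_zero])
    (Measurable.lintegral_prod_right'
      (f := fun q : ℝ × ℝ => bridgeWeight c τ p ((a ^ 2)⁻¹ * q.1 + q.2)) (by fun_prop))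
    hfinite fun y _ => hS.ofReal_mul_lintegral_bridgeWeight hc ha hl hlT hp y
  have := stableHalfBridgeDensity_nonneg (c := a * (c * l)) (by positivity) T.coe_nonneg hTτ y z
  have := hp_nonneg ((a ^ 2)⁻¹ * z) (by positivity)
  positivity

theorem IsStableHalfRandomBridge.affine_increment [IsProbabilityMeasure P] {S : ℝ → Ω → ℝ}
    (hS : IsStableHalfRandomBridge c τ p S P) (hc : 0 < c) (ha : 0 < a) (hl : 0 < l) (hT : 0 < T)
    (hrT : r + l * T ≤ τ) (hlT : l * T < τ) {b : Ω → ℝ} (hb : Measurable b)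
    (hbS : ∀ᵐ ω ∂P, b ω = a ^ 2 * S r ω) {ξ : ℝ → Ω → ℝ}
    (hξ : ∀ t ∈ Icc 0 (T : ℝ), ∀ ω, ξ t ω = a ^ 2 * S (l * t + r) ω - b ω) :
    IsStableHalfRandomBridge (a * (c * l)) T (fun x => (a ^ 2)⁻¹ * ∫ z in Ioi 0,
      stableHalfBridgeDensity (a * (c * l)) T ((l : ℝ)⁻¹ * τ) x z * p ((a ^ 2)⁻¹ * z)) ξ P := by
  obtain ⟨Ω', _, P', _, X, hX, hpath⟩ :=
    hS.exists_hasTiltedPathLaw hc (zero_le.trans_lt hlT)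
  have hend : (l * T + r : ℝ) ≤ τ := by rw [add_comm]; exact_mod_cast hrT
  have htime {t : ℝ} (ht : t ≤ T) : l * t + r ≤ τ := hend.trans' (by gcongr)
  have htime_lt {t : ℝ} (ht : t < T) : l * t + r < τ := hend.trans_lt' (by gcongr)
  have htilted := (hpath.affine_increment hX ha.ne' hrT).congr (Y := fun t : ℝ≥0 => ξ t)
    (fun t ht => by
      rw [funext (hξ t ⟨t.coe_nonneg, by exact_mod_cast ht⟩)]
      exact ((hS.measurable _ ⟨by positivity, htime (by exact_mod_cast ht)⟩).const_mul _).sub hb)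
    (by
      filter_upwards [hbS] with ω hω t ht
      rw [hξ t ⟨t.coe_nonneg, by exact_mod_cast ht⟩, hω, ← mul_sub, add_comm]
      push_cast
      rfl)
  refine htilted.isStableHalfRandomBridge (hX.shift_scale r hl ha) ?_ (fun x _ => ?_) ?_ ?_
    (fun ω t ht => ?_) fun ω t ht => ?_
  · have := hS.density_measurable
    have hbridge := measurable_stableHalfBridgeDensity (a * (c * l)) T ((l : ℝ)⁻¹ * τ)
    exact (StronglyMeasurable.integral_prod_right (hbridge.mul (by fun_prop)).stronglyMeasurable
      ).measurable.const_mul _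
  · have hTτ : (T : ℝ) ≤ (l : ℝ)⁻¹ * τ := NNReal.coe_le_coe.2 (le_inv_mul_iff₀ hl |>.2 hlT.le)
    exact mul_nonneg (by positivity) (setIntegral_nonneg measurableSet_Ioi fun z (hz : 0 < z) =>
      mul_nonneg (stableHalfBridgeDensity_nonneg (by positivity) T.coe_nonneg hTτ _ _)
        (hS.density_nonneg _ (by positivity)))
  · simp only [← integral_const_mul]
    refine hX.lawOfDensity_affine_increment_eq hc ha hl hT hlT hS.density_measurable
      hS.density_nonneg ?_
    rw [← setLIntegral_univ, ← withDensity_apply _ MeasurableSet.univ, ← htilted.map_terminal]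
    exact measure_ne_top _ _
  · filter_upwards [hbS] with ω hω
    simp [hξ 0 ⟨le_rfl, T.coe_nonneg⟩, hω]
  · exact continuousWithinAt_Ici_of_eq_affine l.coe_nonneg ht (hξ · · ω)
      (hS.rightCts ω _ ⟨by have := ht.1; positivity, htime_lt ht.2⟩)
  · exact exists_tendsto_nhdsLT_of_eq_affine (by exact_mod_cast hl) ht (hξ · · ω)
      (hS.leftLim ω _ ⟨by have := ht.1; positivity, htime ht.2⟩)

end AffineTimeChange

theorem le_of_forall_natCast_mul_le_add {a b C : ℝ≥0∞} (hC : C ≠ ∞)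
    (h : ∀ n : ℕ, n * a ≤ n * b + C) : a ≤ b := by
  have hlim : Tendsto (fun n : ℕ => b + C / n) atTop (𝓝 b) := by
    simpa using (ENNReal.Tendsto.const_div ENNReal.tendsto_nat_nhds_top (Or.inr hC)).const_add b
  refine ge_of_tendsto hlim ((eventually_gt_atTop 0).mono fun n hn => ?_)
  have hn0 : (n : ℝ≥0∞) ≠ 0 := by exact_mod_cast hn.ne'
  rw [← ENNReal.mul_le_mul_iff_right hn0 (ENNReal.natCast_ne_top n), mul_add,
    ENNReal.mul_div_cancel hn0 (ENNReal.natCast_ne_top n)]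
  exact h n

section CauchyEquation

variable {g : ℝ≥0 → ℝ≥0∞} {L s t : ℝ≥0}

theorem map_natCast_mul_of_additive (hadd : ∀ a b, a + b ≤ L → g (a + b) = g a + g b) {n : ℕ}
    (hn : 0 < n) (hL : n * s ≤ L) : g (n * s) = n * g s := by
  induction n, hn using Nat.le_induction with
  | base => simp
  | succ n _ ih =>
    push_cast at hL ⊢
    rw [add_mul, one_mul] at hL ⊢
    rw [hadd _ _ hL, ih (le_self_add.trans hL), add_mul, one_mul]

theorem natCast_mul_map_le_of_additive (hadd : ∀ a b, a + b ≤ L → g (a + b) = g a + g b)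
    (hs : s ≤ L) (ht : t ≤ L) {m n : ℕ} (hn : 0 < n) (hmn : m * t ≤ n * s) :
    m * g t ≤ n * g s := by
  rcases Nat.eq_zero_or_pos m with rfl | hm
  · simp
  have hn0 : (0 : ℝ≥0) < n := by exact_mod_cast hn
  have hts : m * (t / n) ≤ s := by
    rw [← mul_div_assoc, div_le_iff₀ hn0, mul_comm s]
    exact hmn
  have ht_eq : g t = n * g (t / n) := by
    rw [← map_natCast_mul_of_additive hadd hn (by rwa [mul_div_cancel₀ _ hn0.ne']),
      mul_div_cancel₀ _ hn0.ne']
  calc (m : ℝ≥0∞) * g t = n * g (m * (t / n)) := by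
        rw [ht_eq, mul_left_comm, map_natCast_mul_of_additive hadd hm (hts.trans hs)]
    _ ≤ n * (g (m * (t / n)) + g (s - m * (t / n))) := mul_le_mul_right le_self_add _
    _ = n * g s := by
        rw [← hadd _ _ ((add_tsub_cancel_of_le hts).trans_le hs), add_tsub_cancel_of_le hts]

theorem mul_map_le_mul_map_of_additive (hadd : ∀ a b, a + b ≤ L → g (a + b) = g a + g b)
    (hs : s ≤ L) (ht : t ≤ L) (ht0 : 0 < t) (hgt : g t ≠ ∞) : s * g t ≤ t * g s := by
  refine le_of_forall_natCast_mul_le_add (ENNReal.mul_ne_top (ENNReal.coe_ne_top (r := t)) hgt)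
    fun n => ?_
  rcases Nat.eq_zero_or_pos n with rfl | hn
  · simp
  set m := ⌊n * s / t⌋₊
  have hlower : m * t ≤ n * s := (le_div_iff₀ ht0).1 (Nat.floor_le zero_le)
  have hupper : n * s ≤ (m + 1) * t := (div_le_iff₀ ht0).1 (Nat.lt_floor_add_one _).le
  calc (n : ℝ≥0∞) * (s * g t) = (n * s : ℝ≥0) * g t := by push_cast; ring
    _ ≤ ((m + 1) * t : ℝ≥0) * g t := by gcongr
    _ = t * (m * g t) + t * g t := by push_cast; ring
    _ ≤ t * (n * g s) + t * g t := by
        gcongr t * ?_ + _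
        exact natCast_mul_map_le_of_additive hadd hs ht hn hlower
    _ = n * (t * g s) + t * g t := by ring

theorem mul_map_eq_mul_map_of_additive (hadd : ∀ a b, a + b ≤ L → g (a + b) = g a + g b)
    (hs : 0 < s) (hsL : s ≤ L) : L * g s = s * g L := by
  have hL : 0 < L := hs.trans_le hsL
  by_cases hgs : g s = ∞
  · have hgL : g L = ∞ := by
      rw [← add_tsub_cancel_of_le hsL, hadd _ _ (add_tsub_cancel_of_le hsL).le, hgs, top_add]
    rw [hgs, hgL, ENNReal.mul_top (by exact_mod_cast hL.ne'),
      ENNReal.mul_top (by exact_mod_cast hs.ne')]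
  have hgL : g L ≠ ∞ := by
    obtain ⟨n, hn⟩ := exists_nat_gt (L / s)
    have hn0 : 0 < n := by exact_mod_cast (div_pos hL hs).trans hn
    have hle := natCast_mul_map_le_of_additive hadd hsL le_rfl (m := 1) hn0
      (by simpa using ((div_lt_iff₀ hs).1 hn).le)
    rw [Nat.cast_one, one_mul] at hle
    exact ne_top_of_le_ne_top (ENNReal.mul_ne_top (ENNReal.natCast_ne_top n) hgs) hle
  exact le_antisymm (mul_map_le_mul_map_of_additive hadd le_rfl hsL hs hgs)
    (mul_map_le_mul_map_of_additive hadd hsL le_rfl hL hgL)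

end CauchyEquation

namespace IsStableHalfSubordinator

variable {Ω : Type*} [MeasurableSpace Ω] {c : ℝ} {S : ℝ≥0 → Ω → ℝ} {P : Measure Ω}
  [IsProbabilityMeasure P]

theorem lintegral_comp_increment_terminal (hS : IsStableHalfSubordinator c S P) {r d τ : ℝ≥0}
    (hrd : r + d ≤ τ) {φ : ℝ × ℝ → ℝ≥0∞} (hφ : Measurable φ) :
    ∫⁻ ω, φ (S (r + d) ω - S r ω, S τ ω) ∂P =
      ∫⁻ x, ∫⁻ y, φ (x, x + y) ∂(P.map (S (τ - d))) ∂(P.map (S d)) := by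
  have := hS.isProbabilityMeasure_map
  have hinc : Measurable fun ω => S (r + d) ω - S r ω := hS.measurable_sub r (r + d)
  have hrest : Measurable fun ω => S r ω + (S τ ω - S (r + d) ω) :=
    (hS.measurable r).add (hS.measurable_sub (r + d) τ)
  have hindep : IndepFun (fun ω => S (r + d) ω - S r ω)
      (fun ω => S r ω + (S τ ω - S (r + d) ω)) P := by
    simpa [Function.comp_def] using (hS.indepFun_affine_increment (l := 1) (T := d)
      (by simpa using hrd)).comp (measurable_pi_apply d) measurable_id
  have hduration : r + (τ - (r + d)) = τ - d := by
    rw [add_comm r, add_comm r, ← tsub_tsub, tsub_add_cancel_of_le (le_tsub_of_add_le_right hrd)]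
  have hlaw := (indepFun_iff_map_prod_eq_prod_map_map hinc.aemeasurable hrest.aemeasurable).1 hindep
  rw [hS.map_add_sub, hS.map_add_increment le_self_add hrd, hduration] at hlaw
  have hφ' : Measurable fun q : ℝ × ℝ => φ (q.1, q.1 + q.2) := by fun_prop
  rw [← lintegral_prod _ hφ'.aemeasurable, ← hlaw, lintegral_map hφ' (hinc.prodMk hrest)]
  refine lintegral_congr fun ω => congrArg (fun w => φ (S (r + d) ω - S r ω, w)) ?_
  ring

theorem mul_lintegral_mul_comp_terminal (hS : IsStableHalfSubordinator c S P) {F : ℝ → ℝ≥0∞}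
    (hF : Measurable F) {d τ : ℝ≥0} (hd : 0 < d) (hdτ : d ≤ τ) :
    τ * ∫⁻ x, ∫⁻ y, ENNReal.ofReal x * F (x + y) ∂(P.map (S (τ - d))) ∂(P.map (S d)) =
      d * ∫⁻ z, ENNReal.ofReal z * F z ∂(P.map (S τ)) := by
  have hmeas : Measurable fun q : ℝ × ℝ => ENNReal.ofReal q.1 * F q.2 := by fun_prop
  have hproc := hS.measurable
  have hadd (a b : ℝ≥0) (hab : a + b ≤ τ) :
      ∫⁻ ω, ENNReal.ofReal (S (a + b) ω) * F (S τ ω) ∂P =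
        ∫⁻ ω, ENNReal.ofReal (S a ω) * F (S τ ω) ∂P +
          ∫⁻ ω, ENNReal.ofReal (S b ω) * F (S τ ω) ∂P := by
    have hb := hS.lintegral_comp_increment_terminal (r := 0) (d := b)
      (by simpa using (le_add_self.trans hab)) hmeas
    simp only [zero_add, hS.start, sub_zero] at hb
    rw [hb, ← hS.lintegral_comp_increment_terminal hab hmeas, ← lintegral_add_left (by fun_prop)]
    refine lintegral_congr fun ω => ?_
    rw [← add_mul, ← ENNReal.ofReal_add (hS.start ω ▸ hS.mono ω zero_le)
      (sub_nonneg.2 (hS.mono ω le_self_add)), add_sub_cancel]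
  have hlin := mul_map_eq_mul_map_of_additive
    (g := fun s => ∫⁻ ω, ENNReal.ofReal (S s ω) * F (S τ ω) ∂P) hadd hd hdτ
  have hd_law := hS.lintegral_comp_increment_terminal (r := 0) (d := d) (by simpa using hdτ) hmeas
  simp only [zero_add, hS.start, sub_zero] at hd_law
  simp only [hd_law] at hlin
  rwa [← lintegral_map (f := fun z => ENNReal.ofReal z * F z) (by fun_prop)
    (hS.measurable τ)] at hlin

end IsStableHalfSubordinator

section Bayes

variable {Ω E F : Type*} {m mΩ : MeasurableSpace Ω} [MeasurableSpace E] [MeasurableSpace F]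
  {P : Measure Ω} {Ψ : Ω → E} {W : Ω → F} {μ : Measure E} {ν : Measure F} [SFinite μ] [SFinite ν]
  {H : E × F → ℝ≥0∞}

theorem setLIntegral_preimage_of_map_prodMk_eq_withDensity (hΨ : Measurable Ψ) (hW : Measurable W)
    (hH : Measurable H) (hlaw : P.map (fun ω => (Ψ ω, W ω)) = (μ.prod ν).withDensity H)
    {k : E × F → ℝ≥0∞} (hk : Measurable k) {B : Set E} (hB : MeasurableSet B) :
    ∫⁻ ω in Ψ ⁻¹' B, k (Ψ ω, W ω) ∂P = ∫⁻ v in B, ∫⁻ w, H (v, w) * k (v, w) ∂ν ∂μ := by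
  have hB' : MeasurableSet (Prod.fst ⁻¹' B : Set (E × F)) := measurable_fst hB
  have hmap := setLIntegral_map (μ := P) hB' hk (hΨ.prodMk hW)
  rw [hlaw, setLIntegral_withDensity_eq_setLIntegral_mul _ hH hk hB', ← prod_univ,
    setLIntegral_prod _ (hH.mul hk).aemeasurable, Measure.restrict_univ] at hmap
  exact (congrArg (fun A => ∫⁻ ω in A, k (Ψ ω, W ω) ∂P) (by ext; simp)).trans hmap.symm

theorem map_eq_withDensity_lintegral_of_map_prodMk (hW : Measurable W)
    (hH : Measurable H) (hlaw : P.map (fun ω => (Ψ ω, W ω)) = (μ.prod ν).withDensity H) :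
    P.map Ψ = μ.withDensity fun v => ∫⁻ w, H (v, w) ∂ν := by
  rw [← map_fst_prod_withDensity hH, ← hlaw]
  exact (Measure.fst_map_prodMk hW).symm

theorem ae_lintegral_ne_zero_of_map_prodMk_eq_withDensity (hW : Measurable W) (hH : Measurable H)
    (hlaw : P.map (fun ω => (Ψ ω, W ω)) = (μ.prod ν).withDensity H) :
    ∀ᵐ v ∂(P.map Ψ), ∫⁻ w, H (v, w) ∂ν ≠ 0 := by
  rw [map_eq_withDensity_lintegral_of_map_prodMk hW hH hlaw,
    ae_withDensity_iff hH.lintegral_prod_right']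
  exact ae_of_all _ fun _ => id

theorem ae_lintegral_mul_ne_top_of_map_prodMk_eq_withDensity (hΨ : Measurable Ψ)
    (hW : Measurable W) (hH : Measurable H)
    (hlaw : P.map (fun ω => (Ψ ω, W ω)) = (μ.prod ν).withDensity H) {k : E × F → ℝ≥0∞}
    (hk : Measurable k) (hfinite : ∫⁻ ω, k (Ψ ω, W ω) ∂P ≠ ∞) :
    ∀ᵐ v ∂(P.map Ψ), ∫⁻ w, H (v, w) * k (v, w) ∂ν ≠ ∞ := by
  have hdisintegrate :=
    setLIntegral_preimage_of_map_prodMk_eq_withDensity hΨ hW hH hlaw hk MeasurableSet.univ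
  rw [preimage_univ, setLIntegral_univ, setLIntegral_univ] at hdisintegrate
  rw [map_eq_withDensity_lintegral_of_map_prodMk hW hH hlaw]
  refine withDensity_absolutelyContinuous _ _ ?_
  filter_upwards [ae_lt_top (hH.mul hk).lintegral_prod_right' (hdisintegrate ▸ hfinite)] with v hv
  exact hv.ne

variable [IsFiniteMeasure P]

theorem condExp_ae_eq_condExp_of_setLIntegral_eq (hm : m ≤ mΩ) {f g : Ω → ℝ}
    (hf : Integrable f P) (hf_nonneg : 0 ≤ᵐ[P] f) (hg : AEStronglyMeasurable g P)
    (hg_nonneg : 0 ≤ᵐ[P] g) (h : ∀ A, MeasurableSet[m] A →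
      ∫⁻ ω in A, ENNReal.ofReal (f ω) ∂P = ∫⁻ ω in A, ENNReal.ofReal (g ω) ∂P) :
    Integrable g P ∧ P[f | m] =ᵐ[P] P[g | m] := by
  have hg_int : Integrable g P := by
    refine ⟨hg, ?_⟩
    rw [hasFiniteIntegral_iff_ofReal hg_nonneg, ← setLIntegral_univ, ← h univ .univ,
      setLIntegral_univ]
    exact hf.lintegral_lt_top
  refine ⟨hg_int, ae_eq_condExp_of_forall_setIntegral_eq hm hg_int
    (fun _ _ _ => integrable_condExp.integrableOn) (fun A hA _ => ?_)
    stronglyMeasurable_condExp.aestronglyMeasurable⟩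
  rw [setIntegral_condExp hm hf hA,
    integral_eq_lintegral_of_nonneg_ae (ae_restrict_of_ae hf_nonneg) hf.1.restrict, h A hA,
    integral_eq_lintegral_of_nonneg_ae (ae_restrict_of_ae hg_nonneg) hg.restrict]

theorem condExp_ae_eq_mul_condExp_of_map_prodMk_eq_withDensity (hΨ : Measurable Ψ)
    (hW : Measurable W) (hH : Measurable H)
    (hlaw : P.map (fun ω => (Ψ ω, W ω)) = (μ.prod ν).withDensity H) (hm : m ≤ mΩ)
    (hmΨ : m ≤ MeasurableSpace.comap Ψ inferInstance) {f g : E × F → ℝ} (hf : Measurable f)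
    (hg : Measurable g) (hf_int : Integrable (fun ω => f (Ψ ω, W ω)) P)
    (hg_int : Integrable (fun ω => g (Ψ ω, W ω)) P) (hf_nonneg : ∀ᵐ ω ∂P, 0 ≤ f (Ψ ω, W ω))
    (hg_nonneg : ∀ᵐ ω ∂P, 0 ≤ g (Ψ ω, W ω)) {r : E → ℝ} (hr : Measurable r)
    (hr_nonneg : ∀ v, 0 ≤ r v) (hrm : Measurable[m] fun ω => r (Ψ ω))
    (h : ∀ᵐ ω ∂P, ∫⁻ w, H (Ψ ω, w) * ENNReal.ofReal (f (Ψ ω, w)) ∂ν =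
      ENNReal.ofReal (r (Ψ ω)) * ∫⁻ w, H (Ψ ω, w) * ENNReal.ofReal (g (Ψ ω, w)) ∂ν) :
    P[fun ω => f (Ψ ω, W ω) | m] =ᵐ[P]
      fun ω => r (Ψ ω) * P[fun ω => g (Ψ ω, W ω) | m] ω := by
  have hHf : Measurable fun q => H q * ENNReal.ofReal (f q) := by fun_prop
  have hHg : Measurable fun q => H q * ENNReal.ofReal (g q) := by fun_prop
  have hfg : ∀ᵐ v ∂μ, ∫⁻ w, H (v, w) * ENNReal.ofReal (f (v, w)) ∂ν =
      ∫⁻ w, H (v, w) * ENNReal.ofReal (r v * g (v, w)) ∂ν := by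
    have hmap := (ae_map_iff hΨ.aemeasurable (measurableSet_eq_fun hHf.lintegral_prod_right'
      (hr.ennreal_ofReal.mul hHg.lintegral_prod_right'))).2 h
    rw [map_eq_withDensity_lintegral_of_map_prodMk hW hH hlaw,
      ae_withDensity_iff hH.lintegral_prod_right'] at hmap
    filter_upwards [hmap] with v hv
    simp only [ENNReal.ofReal_mul (hr_nonneg v), mul_left_comm (H _)]
    rw [lintegral_const_mul _ (by fun_prop)]
    by_cases hmass : ∫⁻ w, H (v, w) ∂ν = 0
    · have hzero : ∀ᵐ w ∂ν, H (v, w) = 0 := (lintegral_eq_zero_iff (by fun_prop)).1 hmass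
      have hvanish (φ : F → ℝ≥0∞) : ∫⁻ w, H (v, w) * φ w ∂ν = 0 :=
        (lintegral_congr_ae (hzero.mono fun w hw => by rw [hw, zero_mul])).trans lintegral_zero
      rw [hvanish, hvanish, mul_zero]
    · exact hv hmass
  obtain ⟨hrg_int, hcond⟩ := condExp_ae_eq_condExp_of_setLIntegral_eq hm hf_int hf_nonneg
    (g := fun ω => r (Ψ ω) * g (Ψ ω, W ω)) (by fun_prop)
    (hg_nonneg.mono fun ω hω => mul_nonneg (hr_nonneg _) hω) fun A hA => by
      obtain ⟨B, hB, rfl⟩ := hmΨ A hA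
      rw [setLIntegral_preimage_of_map_prodMk_eq_withDensity hΨ hW hH hlaw
          (k := fun q => ENNReal.ofReal (f q)) (by fun_prop) hB,
        setLIntegral_preimage_of_map_prodMk_eq_withDensity hΨ hW hH hlaw
          (k := fun q => ENNReal.ofReal (r q.1 * g q)) (by fun_prop) hB]
      exact lintegral_congr_ae (ae_restrict_of_ae hfg)
  exact hcond.trans (condExp_mul_of_stronglyMeasurable_left hrm.stronglyMeasurable hrg_int hg_int)

end Bayes

section ConditionalMean

variable {Ω E : Type*} {m mΩ : MeasurableSpace Ω} [MeasurableSpace E] {P : Measure Ω}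
  [IsProbabilityMeasure P]

theorem measurable_condMeanGiven (Y : Ω → ℝ) (X : Ω → E) : Measurable (condMeanGiven Y X P) :=
  (StronglyMeasurable.integral_condDistrib (f := fun q : E × ℝ => q.2)
    measurable_snd.stronglyMeasurable).measurable

theorem condMeanGiven_eq_of_map_prodMk_eq {X X' : Ω → E} {Y Y' : Ω → ℝ}
    (h : P.map (fun ω => (X ω, Y ω)) = P.map fun ω => (X' ω, Y' ω)) :
    condMeanGiven Y X P = condMeanGiven Y' X' P := by
  funext x
  simp only [condMeanGiven, condDistrib, h]

variable {X : Ω → E} {Z : Ω → ℝ} {g : E → ℝ}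

theorem condMeanGiven_ae_eq_of_condExp_ae_eq (hm : m ≤ mΩ) (hX : Measurable[m] X)
    (hZ : Integrable Z P) (hg : Measurable g) (h : P[Z | m] =ᵐ[P] fun ω => g (X ω)) :
    ∀ᵐ x ∂(P.map X), condMeanGiven Z X P x = g x := by
  have hX' : Measurable X := hX.mono hm le_rfl
  have hcoarse : P[fun ω => g (X ω) | MeasurableSpace.comap X inferInstance] =ᵐ[P]
      P[Z | MeasurableSpace.comap X inferInstance] :=
    (condExp_congr_ae h).symm.trans (condExp_condExp_of_le hX.comap_le hm)
  rw [condExp_of_stronglyMeasurable (f := fun ω => g (X ω)) hX'.comap_le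
    (hg.comp (comap_measurable X)).stronglyMeasurable (integrable_condExp.congr h)] at hcoarse
  refine (ae_map_iff hX'.aemeasurable (measurableSet_eq_fun (measurable_condMeanGiven Z X) hg)).2 ?_
  filter_upwards [hcoarse, condExp_ae_eq_integral_condDistrib' hX' hZ] with ω hgω hcondω
  rw [hgω, hcondω, condMeanGiven]

end ConditionalMean

section Posterior

variable {c : ℝ} {p : ℝ → ℝ}

@[fun_prop]
theorem measurable_posteriorWeight (c τ u : ℝ) (hp : Measurable p) :
    Measurable (Function.uncurry (posteriorWeight c τ p u)) := by
  unfold posteriorWeight Function.uncurry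
  exact Measurable.ite (measurableSet_lt measurable_fst measurable_snd) (by fun_prop)
    measurable_const

theorem posteriorWeight_nonneg (hp_nonneg : ∀ z, 0 < z → 0 ≤ p z) (c τ u y : ℝ) {z : ℝ}
    (hz : 0 < z) : 0 ≤ posteriorWeight c τ p u y z := by
  unfold posteriorWeight
  split_ifs with hyz
  · have := hp_nonneg z hz
    have := sub_pos.2 hyz
    positivity
  · exact le_rfl

theorem posteriorWeight_eq (hc : 0 < c) {u τ : ℝ} (huτ : u < τ) (hτ : 0 < τ) (y : ℝ) {z : ℝ}
    (hz : 0 < z) : posteriorWeight c τ p u y z =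
      τ / (τ - u) * (stableHalfDensity c (τ - u) (z - y) * (p z / stableHalfDensity c τ z)) := by
  unfold posteriorWeight
  split_ifs with hyz
  · have hzy : 0 < z - y := sub_pos.2 hyz
    have hτu : 0 < τ - u := sub_pos.2 huτ
    have hexp : Real.exp (-(c ^ 2 / 2) * ((τ - u) ^ 2 / (z - y) - τ ^ 2 / z)) =
        Real.exp (-(1 / 2) * (c ^ 2 * (τ - u) ^ 2 / (z - y))) /
          Real.exp (-(1 / 2) * (c ^ 2 * τ ^ 2 / z)) := by
      rw [← Real.exp_sub]
      ring_nf
    rw [stableHalfDensity, stableHalfDensity, if_pos hzy, if_pos hz, Real.div_rpow hz.le hzy.le,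
      hexp]
    field_simp
  · rw [stableHalfDensity_of_nonpos (sub_nonpos.2 (not_lt.1 hyz))]
    simp

/-- The mean of the posterior density: the expected terminal value of a random bridge whose value
at time `u` is `y`. -/
noncomputable def posteriorMean (c τ : ℝ) (p : ℝ → ℝ) (u y : ℝ) : ℝ :=
  ∫ z in Ioi 0, z * posteriorDensity c τ p u y z

@[fun_prop]
theorem measurable_posteriorMean (c τ u : ℝ) (hp : Measurable p) :
    Measurable (posteriorMean c τ p u) := by
  have hweight := measurable_posteriorWeight c τ u hp
  have hmass : Measurable fun y => ∫ v in Ioi 0, posteriorWeight c τ p u y v :=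
    (StronglyMeasurable.integral_prod_right' hweight.stronglyMeasurable).measurable
  have hmean : Measurable fun q : ℝ × ℝ => q.2 * posteriorDensity c τ p u q.1 q.2 :=
    measurable_snd.mul ((hmass.comp measurable_fst).inv.mul hweight)
  exact (StronglyMeasurable.integral_prod_right' hmean.stronglyMeasurable).measurable

theorem posteriorMean_nonneg (hp_nonneg : ∀ z, 0 < z → 0 ≤ p z) (c τ u y : ℝ) :
    0 ≤ posteriorMean c τ p u y :=
  have hweight {z : ℝ} (hz : 0 < z) := posteriorWeight_nonneg hp_nonneg c τ u y hz
  setIntegral_nonneg measurableSet_Ioi fun _ hz => mul_nonneg (le_of_lt hz) <| mul_nonneg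
    (inv_nonneg.2 (setIntegral_nonneg measurableSet_Ioi fun _ => hweight)) (hweight hz)

variable {Ω : Type*} [MeasurableSpace Ω] {P : Measure Ω} {S : ℝ≥0 → Ω → ℝ} {u τ : ℝ≥0}
  {f : ℝ → ℝ}

namespace IsStableHalfSubordinator

theorem lintegral_mul_posteriorWeight (hS : IsStableHalfSubordinator c S P) (hc : 0 < c)
    (huτ : u < τ) (hp : Measurable p) (hp_nonneg : ∀ z, 0 < z → 0 ≤ p z) (hf : Measurable f)
    (y : ℝ) :
    ∫⁻ z in Ioi 0, ENNReal.ofReal (f z * posteriorWeight c τ p u y z) =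
      ENNReal.ofReal (τ / (τ - u)) *
        ∫⁻ w, bridgeWeight c τ p (y + w) * ENNReal.ofReal (f (y + w)) ∂(P.map (S (τ - u))) := by
  have huτ' : (u : ℝ) < τ := huτ
  have hτ : (0 : ℝ) < τ := u.coe_nonneg.trans_lt huτ'
  have hτu : (0 : ℝ) < τ - u := sub_pos.2 huτ'
  have := measurable_bridgeWeight c τ hp
  rw [hS.lintegral_comp_const_add (h := fun z => bridgeWeight c τ p z * ENNReal.ofReal (f z))
    (tsub_pos_of_lt huτ) (by fun_prop), ← lintegral_indicator measurableSet_Ioi,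
    ← lintegral_const_mul' _ _ ENNReal.ofReal_ne_top]
  refine lintegral_congr fun z => ?_
  rcases le_or_gt z 0 with hz | hz
  · rw [indicator_of_notMem (by simpa using hz), bridgeWeight_of_nonpos hz]
    simp
  · rw [indicator_of_mem (by simpa using hz),
      ENNReal.ofReal_mul' (posteriorWeight_nonneg hp_nonneg c τ u y hz),
      posteriorWeight_eq hc huτ' hτ y hz, ENNReal.ofReal_mul (by positivity),
      ENNReal.ofReal_mul (stableHalfDensity_nonneg hc.le hτu.le _), bridgeWeight,
      NNReal.coe_sub huτ.le]
    ring

theorem integral_mul_posteriorWeight (hS : IsStableHalfSubordinator c S P) (hc : 0 < c)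
    (huτ : u < τ) (hp : Measurable p) (hp_nonneg : ∀ z, 0 < z → 0 ≤ p z) (hf : Measurable f)
    (hf_nonneg : ∀ z, 0 < z → 0 ≤ f z) {y : ℝ}
    (hfinite : ∫⁻ w, bridgeWeight c τ p (y + w) * ENNReal.ofReal (f (y + w))
      ∂(P.map (S (τ - u))) ≠ ∞) :
    IntegrableOn (fun z => f z * posteriorWeight c τ p u y z) (Ioi 0) ∧
    ∫ z in Ioi 0, f z * posteriorWeight c τ p u y z = τ / (τ - u) *
      (∫⁻ w, bridgeWeight c τ p (y + w) * ENNReal.ofReal (f (y + w)) ∂(P.map (S (τ - u)))).toReal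
      := by
  have huτ' : (u : ℝ) ≤ τ := huτ.le
  have hweight : Measurable (posteriorWeight c τ p u y) :=
    (measurable_posteriorWeight c τ u hp).comp measurable_prodMk_left
  have hnonneg : 0 ≤ᵐ[volume.restrict (Ioi 0)] fun z => f z * posteriorWeight c τ p u y z :=
    (ae_restrict_iff' measurableSet_Ioi).2 (ae_of_all _ fun z hz =>
      mul_nonneg (hf_nonneg z hz) (posteriorWeight_nonneg hp_nonneg c τ u y hz))
  have hmass := hS.lintegral_mul_posteriorWeight hc huτ hp hp_nonneg hf y
  refine ⟨⟨(hf.mul hweight).aestronglyMeasurable, ?_⟩, ?_⟩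
  · rw [hasFiniteIntegral_iff_ofReal hnonneg, hmass]
    exact ENNReal.mul_lt_top ENNReal.ofReal_lt_top hfinite.lt_top
  · rw [integral_eq_lintegral_of_nonneg_ae hnonneg (hf.mul hweight).aestronglyMeasurable, hmass,
      ENNReal.toReal_mul,
      ENNReal.toReal_ofReal (div_nonneg τ.coe_nonneg (sub_nonneg.2 huτ'))]

theorem integral_posteriorWeight (hS : IsStableHalfSubordinator c S P) (hc : 0 < c)
    (huτ : u < τ) (hp : Measurable p) (hp_nonneg : ∀ z, 0 < z → 0 ≤ p z) {y : ℝ}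
    (hfinite : ∫⁻ w, bridgeWeight c τ p (y + w) ∂(P.map (S (τ - u))) ≠ ∞) :
    ∫ z in Ioi 0, posteriorWeight c τ p u y z =
      τ / (τ - u) * (∫⁻ w, bridgeWeight c τ p (y + w) ∂(P.map (S (τ - u)))).toReal := by
  simpa using (hS.integral_mul_posteriorWeight hc huτ hp hp_nonneg (f := fun _ => 1)
    measurable_const (fun _ _ => zero_le_one) (by simpa using hfinite)).2

theorem integral_posteriorDensity (hS : IsStableHalfSubordinator c S P) (hc : 0 < c)
    (huτ : u < τ) (hp : Measurable p) (hp_nonneg : ∀ z, 0 < z → 0 ≤ p z) {y : ℝ}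
    (hmass : ∫⁻ w, bridgeWeight c τ p (y + w) ∂(P.map (S (τ - u))) ≠ 0)
    (hfinite : ∫⁻ w, bridgeWeight c τ p (y + w) ∂(P.map (S (τ - u))) ≠ ∞) :
    ∫ z in Ioi 0, posteriorDensity c τ p u y z = 1 := by
  have huτ' : (u : ℝ) < τ := huτ
  have hτu : (0 : ℝ) < τ / (τ - u) := div_pos (u.coe_nonneg.trans_lt huτ') (sub_pos.2 huτ')
  simp only [posteriorDensity]
  rw [integral_const_mul, inv_mul_cancel₀]
  rw [hS.integral_posteriorWeight hc huτ hp hp_nonneg hfinite]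
  exact (mul_pos hτu (ENNReal.toReal_pos hmass hfinite)).ne'

theorem integrableOn_mul_posteriorDensity (hS : IsStableHalfSubordinator c S P) (hc : 0 < c)
    (huτ : u < τ) (hp : Measurable p) (hp_nonneg : ∀ z, 0 < z → 0 ≤ p z) {y : ℝ}
    (hfinite : ∫⁻ w, bridgeWeight c τ p (y + w) * ENNReal.ofReal (y + w)
      ∂(P.map (S (τ - u))) ≠ ∞) :
    IntegrableOn (fun z => z * posteriorDensity c τ p u y z) (Ioi 0) := by
  simp only [posteriorDensity, mul_left_comm _ (_⁻¹ : ℝ)]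
  exact (hS.integral_mul_posteriorWeight hc huτ hp hp_nonneg measurable_id (fun _ hz => hz.le)
    hfinite).1.const_mul _

theorem ofReal_posteriorMean_mul (hS : IsStableHalfSubordinator c S P) (hc : 0 < c)
    (huτ : u < τ) (hp : Measurable p) (hp_nonneg : ∀ z, 0 < z → 0 ≤ p z) {y : ℝ}
    (hmass : ∫⁻ w, bridgeWeight c τ p (y + w) ∂(P.map (S (τ - u))) ≠ 0)
    (hmass_finite : ∫⁻ w, bridgeWeight c τ p (y + w) ∂(P.map (S (τ - u))) ≠ ∞)
    (hmean_finite : ∫⁻ w, bridgeWeight c τ p (y + w) * ENNReal.ofReal (y + w)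
      ∂(P.map (S (τ - u))) ≠ ∞) :
    ENNReal.ofReal (posteriorMean c τ p u y) *
        ∫⁻ w, bridgeWeight c τ p (y + w) ∂(P.map (S (τ - u))) =
      ∫⁻ w, bridgeWeight c τ p (y + w) * ENNReal.ofReal (y + w) ∂(P.map (S (τ - u))) := by
  have huτ' : (u : ℝ) < τ := huτ
  have hτu : (τ / (τ - u) : ℝ) ≠ 0 := (div_pos (u.coe_nonneg.trans_lt huτ') (sub_pos.2 huτ')).ne'
  have hmass_pos := ENNReal.toReal_pos hmass hmass_finite
  have hmoment := (hS.integral_mul_posteriorWeight hc huτ hp hp_nonneg measurable_id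
    (fun _ hz => hz.le) hmean_finite).2
  simp only [posteriorMean, posteriorDensity, mul_left_comm _ (_⁻¹ : ℝ), id] at hmoment ⊢
  rw [integral_const_mul, hmoment, hS.integral_posteriorWeight hc huτ hp hp_nonneg hmass_finite,
    ← div_eq_inv_mul, mul_div_mul_left _ _ hτu, ENNReal.ofReal_div_of_pos hmass_pos,
    ENNReal.ofReal_toReal hmean_finite, ENNReal.ofReal_toReal hmass_finite,
    ENNReal.div_mul_cancel hmass hmass_finite]

end IsStableHalfSubordinator

end Posterior

section BridgeHistory

theorem tsub_add_tsub_add_eq_tsub {t T s τ : ℝ≥0} (htT : t ≤ T) (hsτ : T + s ≤ τ) :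
    (T - t) + (τ - (T + s)) = τ - (t + s) := by
  refine (tsub_eq_of_eq_add ?_).symm
  rw [← NNReal.coe_inj]
  push_cast [NNReal.coe_sub htT, NNReal.coe_sub hsτ]
  ring

variable {Ω Ω' : Type*}

/-- The information carried by a path `x` up to time `t` together with its increments over
`[T, T + s]`, encoded as a pair of stopped paths. -/
def splitHistory (t T s : ℝ≥0) (x : ℝ≥0 → ℝ) : (ℝ≥0 → ℝ) × (ℝ≥0 → ℝ) :=
  (fun r => x (min r t), fun r => x (T + min r s) - x T)

@[fun_prop]
theorem measurable_splitHistory (t T s : ℝ≥0) : Measurable (splitHistory t T s) := by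
  unfold splitHistory
  fun_prop

theorem splitHistory_pathUpTo {t T s τ : ℝ≥0} (htτ : t ≤ τ) (hsτ : T + s ≤ τ) (X : ℝ≥0 → Ω → ℝ)
    (ω : Ω) : splitHistory t T s (pathUpTo τ X ω) = splitHistory t T s fun r => X r ω := by
  have hinc (r : ℝ≥0) : T + min r s ≤ τ := hsτ.trans' (by gcongr; exact min_le_right r s)
  simp only [splitHistory, pathUpTo_apply_of_le ((min_le_right _ t).trans htτ),
    pathUpTo_apply_of_le (hinc _), pathUpTo_apply_of_le (le_self_add.trans hsτ)]

variable {m mΩ : MeasurableSpace Ω} [MeasurableSpace Ω'] {P : Measure Ω} {P' : Measure Ω'}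
  {c : ℝ} {p : ℝ → ℝ} {g : ℝ → ℝ≥0∞} {t T s τ : ℝ≥0} {X : ℝ≥0 → Ω → ℝ} {S : ℝ≥0 → Ω' → ℝ}

namespace HasTiltedPathLaw

protected theorem measurable_splitHistory (h : HasTiltedPathLaw τ g X P S P') (htτ : t ≤ τ)
    (hsτ : T + s ≤ τ) : Measurable fun ω => splitHistory t T s fun r => X r ω := by
  simp only [← splitHistory_pathUpTo htτ hsτ]
  exact (measurable_splitHistory t T s).comp (measurable_pathUpTo h.measurable_process)

theorem ae_pathUpTo_mem (h : HasTiltedPathLaw τ g X P S P') {A : Set (ℝ≥0 → ℝ)}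
    (hA : MeasurableSet A) (hSA : ∀ᵐ ω ∂P', pathUpTo τ S ω ∈ A) :
    ∀ᵐ ω ∂P, pathUpTo τ X ω ∈ A := by
  refine ae_of_ae_map (measurable_pathUpTo h.measurable_process).aemeasurable ?_
  rw [h.map_eq]
  exact withDensity_absolutelyContinuous _ _
    ((ae_map_iff (measurable_pathUpTo h.measurable_reference).aemeasurable hA).2 hSA)

theorem ae_le (h : HasTiltedPathLaw τ g X P S P') (hS : IsStableHalfSubordinator c S P')
    (hst : s ≤ t) (htτ : t ≤ τ) : ∀ᵐ ω ∂P, X s ω ≤ X t ω := by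
  have hpath := h.ae_pathUpTo_mem (A := {x | x s ≤ x t})
    (measurableSet_le (by fun_prop) (by fun_prop))
    (ae_of_all _ fun ω => hS.mono ω (min_le_min_right τ hst))
  filter_upwards [hpath] with ω hω
  rwa [pathUpTo_apply_of_le (hst.trans htτ), pathUpTo_apply_of_le htτ] at hω

theorem ae_nonneg (h : HasTiltedPathLaw τ g X P S P') (hS : IsStableHalfSubordinator c S P')
    (htτ : t ≤ τ) : ∀ᵐ ω ∂P, 0 ≤ X t ω := by
  have hpath := h.ae_pathUpTo_mem (A := {x | 0 ≤ x t})
    (measurableSet_le (by fun_prop) (by fun_prop))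
    (ae_of_all _ fun ω => (hS.start ω).symm.trans_le (hS.mono ω zero_le))
  filter_upwards [hpath] with ω hω
  rwa [pathUpTo_apply_of_le htτ] at hω

theorem integrable (h : HasTiltedPathLaw τ g X P S P') (hS : IsStableHalfSubordinator c S P')
    (hint : Integrable (X τ) P) (htτ : t ≤ τ) : Integrable (X t) P := by
  refine hint.mono' (h.measurable_process t htτ).aestronglyMeasurable ?_
  filter_upwards [h.ae_le hS htτ le_rfl, h.ae_nonneg hS htτ] with ω hle hnonneg
  rwa [Real.norm_of_nonneg hnonneg]

end HasTiltedPathLaw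

namespace IsStableHalfSubordinator

variable [IsProbabilityMeasure P']

theorem indepFun_splitHistory (hS : IsStableHalfSubordinator c S P') (htT : t ≤ T)
    (hsτ : T + s ≤ τ) :
    IndepFun (fun ω => splitHistory t T s fun r => S r ω)
      (fun ω => (S T ω - S t ω, S τ ω - S (T + s) ω)) P' := by
  have hincrements := indepFun_increments_of_disjoint hS.measurable hS.indep
    (u := fun i : ℝ≥0 ⊕ ℝ≥0 => i.elim 0 fun _ => T)
    (v := fun i => i.elim (min · t) (T + min · s))
    (u' := fun i : Bool => bif i then T + s else t) (v' := fun i => bif i then τ else T)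
    (fun i => by cases i <;> simp) (fun i => by cases i <;> simpa) ?_
  · have hhistory : Measurable fun x : ℝ≥0 ⊕ ℝ≥0 → ℝ =>
        (fun r => x (Sum.inl r), fun r => x (Sum.inr r)) := by fun_prop
    have hgaps : Measurable fun x : Bool → ℝ => (x false, x true) := by fun_prop
    simpa [Function.comp_def, hS.start, splitHistory] using! hincrements.comp hhistory hgaps
  · have hinc (r : ℝ≥0) : T + min r s ≤ T + s := by gcongr; exact min_le_right r s
    rintro (r | r) (_ | _)
    · exact Ioc_disjoint_Ioc_of_le (min_le_right r t)
    · exact Ioc_disjoint_Ioc_of_le ((min_le_right r t).trans (htT.trans le_self_add))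
    · exact (Ioc_disjoint_Ioc_of_le le_rfl).symm
    · exact Ioc_disjoint_Ioc_of_le (hinc r)

theorem map_sub_prodMk_sub (hS : IsStableHalfSubordinator c S P') (htT : t ≤ T)
    (hsτ : T + s ≤ τ) :
    P'.map (fun ω => (S T ω - S t ω, S τ ω - S (T + s) ω)) =
      (P'.map (S (T - t))).prod (P'.map (S (τ - (T + s)))) := by
  rw [(indepFun_iff_map_prod_eq_prod_map_map (hS.measurable_sub t T).aemeasurable
    (hS.measurable_sub (T + s) τ).aemeasurable).1 (hS.indepFun_sub_sub htT le_self_add hsτ),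
    ← hS.map_add_sub t, ← hS.map_add_sub (T + s), add_tsub_cancel_of_le htT,
    add_tsub_cancel_of_le hsτ]

theorem lintegral_prod_map_comp_add (hS : IsStableHalfSubordinator c S P') {F : ℝ → ℝ≥0∞}
    (hF : Measurable F) (a b : ℝ≥0) :
    ∫⁻ w, F (w.1 + w.2) ∂((P'.map (S a)).prod (P'.map (S b))) =
      ∫⁻ z, F z ∂(P'.map (S (a + b))) := by
  rw [hS.map_add, Measure.conv, lintegral_map hF (by fun_prop)]

theorem lintegral_prod_map_mul_ofReal_fst (hS : IsStableHalfSubordinator c S P') {F : ℝ → ℝ≥0∞}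
    (hF : Measurable F) {a b : ℝ≥0} (ha : 0 < a) :
    ∫⁻ w, F (w.1 + w.2) * ENNReal.ofReal w.1 ∂((P'.map (S a)).prod (P'.map (S b))) =
      ENNReal.ofReal (a / (a + b : ℝ≥0)) * ∫⁻ w, F (w.1 + w.2) * ENNReal.ofReal (w.1 + w.2)
        ∂((P'.map (S a)).prod (P'.map (S b))) := by
  have hab : a + b ≠ 0 := (ha.trans_le le_self_add).ne'
  have := hS.isProbabilityMeasure_map
  have hratio := hS.mul_lintegral_mul_comp_terminal hF ha (le_self_add (b := b))
  rw [add_tsub_cancel_left,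
    ← lintegral_prod (fun w : ℝ × ℝ => ENNReal.ofReal w.1 * F (w.1 + w.2)) (by fun_prop)] at hratio
  rw [hS.lintegral_prod_map_comp_add (F := fun z => F z * ENNReal.ofReal z) (by fun_prop),
    ← NNReal.coe_div, ENNReal.ofReal_coe_nnreal, ENNReal.coe_div hab, ENNReal.div_eq_inv_mul,
    mul_assoc]
  simp only [mul_comm (F _)]
  rw [← hratio, ENNReal.inv_mul_cancel_left (by exact_mod_cast hab) ENNReal.coe_ne_top]

end IsStableHalfSubordinator

namespace HasTiltedPathLaw

variable [IsProbabilityMeasure P']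

theorem map_splitHistory_prodMk (h : HasTiltedPathLaw τ g X P S P')
    (hS : IsStableHalfSubordinator c S P') (htT : t ≤ T) (hsτ : T + s ≤ τ) :
    P.map (fun ω => (splitHistory t T s fun r => X r ω, (X T ω - X t ω, X τ ω - X (T + s) ω))) =
      ((P'.map fun ω => splitHistory t T s fun r => S r ω).prod
        ((P'.map (S (T - t))).prod (P'.map (S (τ - (T + s)))))).withDensity
          fun q => g (q.1.1 t + q.1.2 s + (q.2.1 + q.2.2)) := by
  have hTτ : T ≤ τ := le_self_add.trans hsτ
  have htτ := htT.trans hTτ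
  have hlaw := h.map_prodMk_of_indepFun (measurable_splitHistory t T s)
    (B := fun x => (x T - x t, x τ - x (T + s)))
    (e := fun q => q.1.1 t + q.1.2 s + (q.2.1 + q.2.2)) (by fun_prop) (by fun_prop)
    (fun x => by simp only [splitHistory, min_self]; abel)
  simp only [splitHistory_pathUpTo htτ hsτ, pathUpTo_apply_of_le htτ, pathUpTo_apply_of_le hTτ,
    pathUpTo_apply_of_le hsτ, pathUpTo_apply_of_le le_rfl] at hlaw
  rw [hlaw (hS.indepFun_splitHistory htT hsτ), hS.map_sub_prodMk_sub htT hsτ]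

theorem map_splitValue_prodMk (h : HasTiltedPathLaw τ g X P S P')
    (hS : IsStableHalfSubordinator c S P') (htT : t ≤ T) (hsτ : T + s ≤ τ) :
    P.map (fun ω => (X t ω + (X (T + s) ω - X T ω), (X T ω - X t ω) + (X τ ω - X (T + s) ω))) =
      ((P'.map (S (t + s))).prod (P'.map (S (τ - (t + s))))).withDensity
        fun q => g (q.1 + q.2) := by
  have hTτ : T ≤ τ := le_self_add.trans hsτ
  have htτ := htT.trans hTτ
  have hlaw := h.map_prodMk_of_indepFun (A := fun x => x t + (x (T + s) - x T))
    (B := fun x => (x T - x t) + (x τ - x (T + s))) (e := fun q => q.1 + q.2) (by fun_prop)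
    (by fun_prop) (by fun_prop) (fun x => by ring)
  have hindep := (hS.indepFun_splitHistory htT hsτ).comp (φ := fun x => x.1 t + x.2 s)
    (ψ := fun w => w.1 + w.2) (by fun_prop) (by fun_prop)
  simp only [pathUpTo_apply_of_le htτ, pathUpTo_apply_of_le hTτ, pathUpTo_apply_of_le hsτ,
    pathUpTo_apply_of_le le_rfl] at hlaw
  simp only [Function.comp_def, splitHistory, min_self] at hindep
  rw [hlaw hindep, hS.map_add_increment htT le_self_add, hS.map_sub_add_sub htT le_self_add hsτ,
    add_tsub_cancel_left, tsub_add_tsub_add_eq_tsub htT hsτ]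

theorem map_prodMk_splitValue_terminal (h : HasTiltedPathLaw τ g X P S P')
    (hS : IsStableHalfSubordinator c S P') (htT : t ≤ T) (hsτ : T + s ≤ τ) :
    P.map (fun ω => (X t ω + (X (T + s) ω - X T ω), X τ ω)) =
      P.map fun ω => (X (t + s) ω, X τ ω) := by
  have huτ : t + s ≤ τ := hsτ.trans' (by gcongr)
  have hsum : Measurable fun q : ℝ × ℝ => (q.1, q.1 + q.2) := by fun_prop
  have htT' := h.measurable_process t (htT.trans (le_self_add.trans hsτ))
  have hT := h.measurable_process T (le_self_add.trans hsτ)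
  have hs := h.measurable_process _ hsτ
  have hu := h.measurable_process _ huτ
  have hτ := h.measurable_process τ le_rfl
  have hsplit := h.map_splitValue_prodMk hS htT hsτ
  have hdirect := h.map_splitValue_prodMk hS (t := t + s) (T := t + s) (s := 0) le_rfl
    (by simpa using huτ)
  simp only [add_zero, sub_self, zero_add] at hdirect
  have hmap := congrArg (Measure.map fun q : ℝ × ℝ => (q.1, q.1 + q.2)) (hsplit.trans hdirect.symm)
  rw [Measure.map_map hsum (by fun_prop), Measure.map_map hsum (by fun_prop)] at hmap
  have hterminal (ω : Ω) : X t ω + (X (T + s) ω - X T ω) +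
      (X T ω - X t ω + (X τ ω - X (T + s) ω)) = X τ ω := by ring
  simpa [Function.comp_def, hterminal] using! hmap

variable [IsProbabilityMeasure P]

theorem ae_lintegral_weight_ne_zero_ne_top (h : HasTiltedPathLaw τ g X P S P')
    (hS : IsStableHalfSubordinator c S P') (hint : Integrable (X τ) P) (htT : t ≤ T)
    (hsτ : T + s ≤ τ) :
    ∀ᵐ y ∂(P.map fun ω => X t ω + (X (T + s) ω - X T ω)),
      ∫⁻ w, g (y + w) ∂(P'.map (S (τ - (t + s)))) ≠ 0 ∧
      ∫⁻ w, g (y + w) ∂(P'.map (S (τ - (t + s)))) ≠ ∞ ∧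
      ∫⁻ w, g (y + w) * ENNReal.ofReal (y + w) ∂(P'.map (S (τ - (t + s)))) ≠ ∞ := by
  have hXt := h.measurable_process t (htT.trans (le_self_add.trans hsτ))
  have hXT := h.measurable_process T (le_self_add.trans hsτ)
  have hXs := h.measurable_process _ hsτ
  have hXτ := h.measurable_process τ le_rfl
  have hg := h.measurable_weight
  have := hS.isProbabilityMeasure_map
  have hlaw := h.map_splitValue_prodMk hS htT hsτ
  have hvalue : Measurable fun ω => X t ω + (X (T + s) ω - X T ω) := by fun_prop
  have hrest : Measurable fun ω => X T ω - X t ω + (X τ ω - X (T + s) ω) := by fun_prop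
  have hmass := ae_lintegral_mul_ne_top_of_map_prodMk_eq_withDensity hvalue hrest (by fun_prop) hlaw
    (k := fun _ => 1) measurable_const (by simp)
  have hmean := ae_lintegral_mul_ne_top_of_map_prodMk_eq_withDensity hvalue hrest (by fun_prop) hlaw
    (k := fun q => ENNReal.ofReal (q.1 + q.2)) (by fun_prop) (by
      ring_nf
      exact hint.lintegral_lt_top.ne)
  filter_upwards [ae_lintegral_ne_zero_of_map_prodMk_eq_withDensity hrest (by fun_prop) hlaw,
    hmass, hmean] with y hne hfinite hmean_finite
  exact ⟨hne, by simpa using hfinite, hmean_finite⟩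

theorem condExp_terminal_ae_eq_posteriorMean (h : HasTiltedPathLaw τ (bridgeWeight c τ p) X P S P')
    (hS : IsStableHalfSubordinator c S P') (hc : 0 < c) (hp : Measurable p)
    (hp_nonneg : ∀ z, 0 < z → 0 ≤ p z) (hint : Integrable (X τ) P) (htT : t < T)
    (hsτ : T + s ≤ τ) (hm : m ≤ mΩ)
    (hm_hist : m ≤
      MeasurableSpace.comap (fun ω => splitHistory t T s fun r => X r ω) inferInstance)
    (hvalue : Measurable[m] fun ω => X t ω + (X (T + s) ω - X T ω)) :
    P[X τ | m] =ᵐ[P] fun ω =>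
      posteriorMean c τ p (t + s : ℝ≥0) (X t ω + (X (T + s) ω - X T ω)) := by
  have hTτ : T ≤ τ := le_self_add.trans hsτ
  have htτ : t ≤ τ := htT.le.trans hTτ
  have huτ : t + s < τ := (add_lt_add_left htT s).trans_le hsτ
  have hXt := h.measurable_process t htτ
  have hXT := h.measurable_process T hTτ
  have hXs := h.measurable_process _ hsτ
  have hXτ := h.measurable_process τ le_rfl
  have := h.measurable_weight
  have := hS.isProbabilityMeasure_map
  have hterminal (ω : Ω) : X t ω + (X (T + s) ω - X T ω) +
      (X T ω - X t ω + (X τ ω - X (T + s) ω)) = X τ ω := by ring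
  have hbayes := condExp_ae_eq_mul_condExp_of_map_prodMk_eq_withDensity
    (h.measurable_splitHistory htτ hsτ) (by fun_prop) (by fun_prop)
    (h.map_splitHistory_prodMk hS htT.le hsτ) hm hm_hist
    (f := fun q => q.1.1 t + q.1.2 s + (q.2.1 + q.2.2)) (g := fun _ => 1) (by fun_prop)
    measurable_const
    (by simpa only [splitHistory, min_self, hterminal] using hint) (integrable_const 1)
    (by simpa only [splitHistory, min_self, hterminal] using h.ae_nonneg hS le_rfl)
    (ae_of_all _ fun _ => zero_le_one)
    (r := fun v => posteriorMean c τ p (t + s : ℝ≥0) (v.1 t + v.2 s)) (by fun_prop)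
    (fun _ => posteriorMean_nonneg hp_nonneg _ _ _ _)
    (by
      simp only [splitHistory, min_self]
      exact (measurable_posteriorMean c τ _ hp).comp hvalue)
    (by
      filter_upwards [ae_of_ae_map (by fun_prop)
        (h.ae_lintegral_weight_ne_zero_ne_top hS hint htT.le hsτ)] with
        ω ⟨hmass, hmass_finite, hmean_finite⟩
      have hmean :=
        hS.ofReal_posteriorMean_mul hc huτ hp hp_nonneg hmass hmass_finite hmean_finite
      rw [← tsub_add_tsub_add_eq_tsub htT.le hsτ, ← hS.lintegral_prod_map_comp_add (by fun_prop),
        ← hS.lintegral_prod_map_comp_add (by fun_prop)] at hmean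
      simpa [splitHistory] using hmean.symm)
  simpa only [splitHistory, min_self, hterminal, condExp_const hm, mul_one] using hbayes

theorem condExp_gap (h : HasTiltedPathLaw τ g X P S P')
    (hS : IsStableHalfSubordinator c S P') (hint : Integrable (X τ) P) (htT : t < T)
    (hsτ : T + s ≤ τ) (hm : m ≤ mΩ)
    (hm_hist : m ≤
      MeasurableSpace.comap (fun ω => splitHistory t T s fun r => X r ω) inferInstance) :
    P[fun ω => X T ω - X t ω | m] =ᵐ[P] fun ω => ((T : ℝ) - t) / (τ - (t + s)) *
      P[fun ω => (X T ω - X t ω) + (X τ ω - X (T + s) ω) | m] ω := by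
  have hTτ : T ≤ τ := le_self_add.trans hsτ
  have htτ : t ≤ τ := htT.le.trans hTτ
  have huτ : t + s < τ := (add_lt_add_left htT s).trans_le hsτ
  have hXt := h.measurable_process t htτ
  have hXT := h.measurable_process T hTτ
  have hXs := h.measurable_process _ hsτ
  have hXτ := h.measurable_process τ le_rfl
  have hg := h.measurable_weight
  have hgap : Integrable (fun ω => X T ω - X t ω) P :=
    (h.integrable hS hint hTτ).sub (h.integrable hS hint htτ)
  have hgap_nonneg : ∀ᵐ ω ∂P, 0 ≤ X T ω - X t ω :=
    (h.ae_le hS htT.le hTτ).mono fun _ => sub_nonneg.2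
  have hrest_nonneg : ∀ᵐ ω ∂P, 0 ≤ X τ ω - X (T + s) ω :=
    (h.ae_le hS hsτ le_rfl).mono fun _ => sub_nonneg.2
  have := hS.isProbabilityMeasure_map
  have huτ' : ((t : ℝ) + s) < τ := by exact_mod_cast huτ
  refine condExp_ae_eq_mul_condExp_of_map_prodMk_eq_withDensity
    (h.measurable_splitHistory htτ hsτ) (by fun_prop) (by fun_prop)
    (h.map_splitHistory_prodMk hS htT.le hsτ) hm hm_hist (f := fun q => q.2.1)
    (g := fun q => q.2.1 + q.2.2) (by fun_prop) (by fun_prop) hgap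
    (hgap.add (hint.sub (h.integrable hS hint hsτ))) hgap_nonneg
    (by filter_upwards [hgap_nonneg, hrest_nonneg] with ω using add_nonneg)
    (r := fun _ => ((T : ℝ) - t) / (τ - (t + s))) measurable_const
    (fun _ => div_nonneg (sub_nonneg.2 htT.le) (sub_pos.2 huτ').le) measurable_const
    (ae_of_all _ fun ω => ?_)
  have hratio := hS.lintegral_prod_map_mul_ofReal_fst (b := τ - (T + s))
    (F := fun z => g (X t ω + (X (T + s) ω - X T ω) + z)) (by fun_prop) (tsub_pos_of_lt htT)
  rw [tsub_add_tsub_add_eq_tsub htT.le hsτ, NNReal.coe_sub htT.le, NNReal.coe_sub huτ.le,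
    NNReal.coe_add] at hratio
  simpa [splitHistory] using hratio

theorem condMeanGiven_terminal_ae_eq (h : HasTiltedPathLaw τ (bridgeWeight c τ p) X P S P')
    (hS : IsStableHalfSubordinator c S P') (hc : 0 < c) (hp : Measurable p)
    (hp_nonneg : ∀ z, 0 < z → 0 ≤ p z) (hint : Integrable (X τ) P) (htT : t < T)
    (hsτ : T + s ≤ τ) :
    ∀ᵐ y ∂(P.map fun ω => X t ω + (X (T + s) ω - X T ω)),
      condMeanGiven (X τ) (X (t + s)) P y = posteriorMean c τ p (t + s : ℝ≥0) y := by
  have htτ : t ≤ τ := htT.le.trans (le_self_add.trans hsτ)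
  rw [← condMeanGiven_eq_of_map_prodMk_eq (h.map_prodMk_splitValue_terminal hS htT.le hsτ)]
  have hvalue_hist : Measurable[MeasurableSpace.comap
      (fun ω => splitHistory t T s fun r => X r ω) inferInstance]
      fun ω => X t ω + (X (T + s) ω - X T ω) := by
    have hsum : Measurable fun v : (ℝ≥0 → ℝ) × (ℝ≥0 → ℝ) => v.1 t + v.2 s := by fun_prop
    simpa [Function.comp_def, splitHistory] using!
      hsum.comp (comap_measurable fun ω => splitHistory t T s fun r => X r ω)
  have hm := (h.measurable_splitHistory htτ hsτ).comap_le
  exact condMeanGiven_ae_eq_of_condExp_ae_eq hm hvalue_hist hint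
    (measurable_posteriorMean c τ _ hp)
    (h.condExp_terminal_ae_eq_posteriorMean hS hc hp hp_nonneg hint htT hsτ hm le_rfl hvalue_hist)

theorem ae_integral_posteriorDensity_eq_one (h : HasTiltedPathLaw τ (bridgeWeight c τ p) X P S P')
    (hS : IsStableHalfSubordinator c S P') (hc : 0 < c) (hp : Measurable p)
    (hp_nonneg : ∀ z, 0 < z → 0 ≤ p z) (hint : Integrable (X τ) P) (htT : t < T)
    (hsτ : T + s ≤ τ) :
    ∀ᵐ y ∂(P.map fun ω => X t ω + (X (T + s) ω - X T ω)),
      ∫ z in Ioi 0, posteriorDensity c τ p (t + s : ℝ≥0) y z = 1 ∧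
      IntegrableOn (fun z => z * posteriorDensity c τ p (t + s : ℝ≥0) y z) (Ioi 0) := by
  have huτ : t + s < τ := (add_lt_add_left htT s).trans_le hsτ
  filter_upwards [h.ae_lintegral_weight_ne_zero_ne_top hS hint htT.le hsτ]
    with y ⟨hmass, hfinite, hmean⟩
  exact ⟨hS.integral_posteriorDensity hc huτ hp hp_nonneg hmass hfinite,
    hS.integrableOn_mul_posteriorDensity hc huτ hp hp_nonneg hmean⟩

theorem condExp_terminal_ae_eq_condMeanGiven
    (h : HasTiltedPathLaw τ (bridgeWeight c τ p) X P S P') (hS : IsStableHalfSubordinator c S P')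
    (hc : 0 < c) (hp : Measurable p) (hp_nonneg : ∀ z, 0 < z → 0 ≤ p z)
    (hint : Integrable (X τ) P) (htT : t < T) (hsτ : T + s ≤ τ) (hm : m ≤ mΩ)
    (hm_hist : m ≤
      MeasurableSpace.comap (fun ω => splitHistory t T s fun r => X r ω) inferInstance)
    (hvalue : Measurable[m] fun ω => X t ω + (X (T + s) ω - X T ω)) :
    P[X τ | m] =ᵐ[P] fun ω =>
      condMeanGiven (X τ) (X (t + s)) P (X t ω + (X (T + s) ω - X T ω)) := by
  filter_upwards [h.condExp_terminal_ae_eq_posteriorMean hS hc hp hp_nonneg hint htT hsτ hm hm_hist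
    hvalue, ae_of_ae_map (hvalue.mono hm le_rfl).aemeasurable
    (h.condMeanGiven_terminal_ae_eq hS hc hp hp_nonneg hint htT hsτ)] with ω hω hmean
  rw [hω, hmean]

theorem condExp_intermediate (h : HasTiltedPathLaw τ g X P S P')
    (hS : IsStableHalfSubordinator c S P') (hint : Integrable (X τ) P) (htT : t < T)
    (hsτ : T + s ≤ τ) (hm : m ≤ mΩ)
    (hm_hist : m ≤
      MeasurableSpace.comap (fun ω => splitHistory t T s fun r => X r ω) inferInstance)
    (hXt : Measurable[m] (X t)) (hXs : Measurable[m] fun ω => X (T + s) ω - X T ω) :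
    P[X T | m] =ᵐ[P] fun ω =>
      ((T : ℝ) - t) / (τ - (t + s)) * (P[X τ | m] ω - (X (T + s) ω - X T ω)) +
        ((τ : ℝ) - (T + s)) / (τ - (t + s)) * X t ω := by
  have hTτ : T ≤ τ := le_self_add.trans hsτ
  have hint_t : Integrable (X t) P := h.integrable hS hint (htT.le.trans hTτ)
  have hint_T : Integrable (X T) P := h.integrable hS hint hTτ
  have hvalue : Measurable[m] fun ω => X t ω + (X (T + s) ω - X T ω) := hXt.add hXs
  have hint_value : Integrable (fun ω => X t ω + (X (T + s) ω - X T ω)) P :=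
    hint_t.add ((h.integrable hS hint hsτ).sub hint_T)
  have hgaps : (fun ω => (X T ω - X t ω) + (X τ ω - X (T + s) ω)) =
      X τ - fun ω => X t ω + (X (T + s) ω - X T ω) := by
    funext ω
    simp only [Pi.sub_apply]
    ring
  have huτ : (0 : ℝ) < τ - (t + s) :=
    sub_pos.2 (by exact_mod_cast (add_lt_add_left htT s).trans_le hsτ)
  have hgap := h.condExp_gap hS hint htT hsτ hm hm_hist
  have hrest := condExp_sub hint hint_value m
  have hincr := condExp_sub hint_T hint_t m
  rw [condExp_of_stronglyMeasurable hm hvalue.stronglyMeasurable hint_value, ← hgaps] at hrest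
  rw [condExp_of_stronglyMeasurable hm hXt.stronglyMeasurable hint_t] at hincr
  filter_upwards [hgap, hrest, hincr] with ω hgap hrest hincr
  rw [eq_add_of_sub_eq' (hincr.symm.trans (hgap.trans (congrArg _ hrest))), Pi.sub_apply]
  field_simp
  ring

theorem condExp_terminal_sub_intermediate (h : HasTiltedPathLaw τ g X P S P')
    (hS : IsStableHalfSubordinator c S P') (hint : Integrable (X τ) P) (htT : t < T)
    (hsτ : T + s ≤ τ) (hm : m ≤ mΩ)
    (hm_hist : m ≤
      MeasurableSpace.comap (fun ω => splitHistory t T s fun r => X r ω) inferInstance)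
    (hXt : Measurable[m] (X t)) (hXs : Measurable[m] fun ω => X (T + s) ω - X T ω) :
    P[fun ω => X τ ω - X T ω | m] =ᵐ[P] fun ω =>
      ((τ : ℝ) - (T + s)) / (τ - (t + s)) * (P[X τ | m] ω - X t ω) +
        ((T : ℝ) - t) / (τ - (t + s)) * (X (T + s) ω - X T ω) := by
  have huτ : (0 : ℝ) < τ - (t + s) :=
    sub_pos.2 (by exact_mod_cast (add_lt_add_left htT s).trans_le hsτ)
  filter_upwards [condExp_sub hint (h.integrable hS hint (le_self_add.trans hsτ)) m,
    h.condExp_intermediate hS hint htT hsτ hm hm_hist hXt hXs] with ω hsub hintermediate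
  refine hsub.trans ?_
  rw [Pi.sub_apply, hintermediate]
  field_simp
  ring

end HasTiltedPathLaw
end BridgeHistory

section JointHistory

variable {Ω : Type*} {ξ₁ ξ₂ : ℝ → Ω → ℝ}

theorem jointHistory_le {m : MeasurableSpace Ω} {t : ℝ}
    (hξ₁ : ∀ s ∈ Icc 0 t, Measurable[m] (ξ₁ s)) (hξ₂ : ∀ s ∈ Icc 0 t, Measurable[m] (ξ₂ s)) :
    jointHistory ξ₁ ξ₂ t ≤ m :=
  iSup₂_le fun s hs => sup_le (hξ₁ s hs).comap_le (hξ₂ s hs).comap_le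

theorem measurable_prodMk_jointHistory (ξ₁ ξ₂ : ℝ → Ω → ℝ) {t : ℝ} (ht : 0 ≤ t) :
    Measurable[jointHistory ξ₁ ξ₂ t] fun ω => (ξ₁ t ω, ξ₂ t ω) := by
  have hle : MeasurableSpace.comap (ξ₁ t) inferInstance ⊔ MeasurableSpace.comap (ξ₂ t) inferInstance
      ≤ jointHistory ξ₁ ξ₂ t :=
    le_iSup₂ (f := fun s (_ : s ∈ Icc 0 t) => MeasurableSpace.comap (ξ₁ s) inferInstance ⊔
      MeasurableSpace.comap (ξ₂ s) inferInstance) t ⟨ht, le_rfl⟩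
  exact ((comap_measurable (ξ₁ t)).mono (le_sup_left.trans hle) le_rfl).prodMk
    ((comap_measurable (ξ₂ t)).mono (le_sup_right.trans hle) le_rfl)

/-- Up to time `t`, the process `ξ₁` follows the path of `X` from time `0` on, and `ξ₂` follows its
increments from time `T` on, at speed `l` and magnified by the factor `a`. -/
structure IsSplitting (X : ℝ≥0 → Ω → ℝ) (t T l : ℝ≥0) (a : ℝ) (ξ₁ ξ₂ : ℝ → Ω → ℝ) : Prop where
  scale_ne_zero : a ≠ 0
  fst_eq : ∀ r ≤ t, ξ₁ r = X r
  snd_eq : ∀ r ≤ t, ξ₂ r = fun ω => a * (X (T + l * r) ω - X T ω)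

variable {a : ℝ} {l t T τ : ℝ≥0} {X : ℝ≥0 → Ω → ℝ}

namespace IsSplitting

theorem mono (hξ : IsSplitting X T T l a ξ₁ ξ₂) (htT : t ≤ T) : IsSplitting X t T l a ξ₁ ξ₂ where
  scale_ne_zero := hξ.scale_ne_zero
  fst_eq r hr := hξ.fst_eq r (hr.trans htT)
  snd_eq r hr := hξ.snd_eq r (hr.trans htT)

theorem increment_eq (hξ : IsSplitting X t T l a ξ₁ ξ₂) (ω : Ω) :
    X (T + l * t) ω - X T ω = a⁻¹ * ξ₂ t ω := by
  rw [hξ.snd_eq t le_rfl, inv_mul_cancel_left₀ hξ.scale_ne_zero]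

theorem jointHistory_le_comap_splitHistory (hξ : IsSplitting X t T l a ξ₁ ξ₂) :
    jointHistory ξ₁ ξ₂ t ≤
      MeasurableSpace.comap (fun ω => splitHistory t T (l * t) fun r => X r ω) inferInstance := by
  have hhist := comap_measurable (m := inferInstance)
    fun ω => splitHistory t T (l * t) fun r => X r ω
  refine jointHistory_le (fun r hr => ?_) fun r hr => ?_ <;> lift r to ℝ≥0 using hr.1 <;>
    have hrt : r ≤ t := NNReal.coe_le_coe.1 hr.2
  · have hread : Measurable fun v : (ℝ≥0 → ℝ) × (ℝ≥0 → ℝ) => v.1 r := by fun_prop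
    simpa [hξ.fst_eq r hrt, Function.comp_def, splitHistory, min_eq_left hrt]
      using! hread.comp hhist
  · have hread : Measurable fun v : (ℝ≥0 → ℝ) × (ℝ≥0 → ℝ) => a * v.2 (l * r) := by fun_prop
    simpa [hξ.snd_eq r hrt, Function.comp_def, splitHistory, min_eq_left (mul_le_mul_right hrt l)]
      using! hread.comp hhist

end IsSplitting

namespace HasTiltedPathLaw

variable {Ω' : Type*} [MeasurableSpace Ω] [MeasurableSpace Ω'] {P : Measure Ω} {P' : Measure Ω'}
  [IsProbabilityMeasure P] [IsProbabilityMeasure P'] {c : ℝ} {p : ℝ → ℝ} {S : ℝ≥0 → Ω' → ℝ}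

theorem condExp_jointHistory (h : HasTiltedPathLaw τ (bridgeWeight c τ p) X P S P')
    (hS : IsStableHalfSubordinator c S P') (hc : 0 < c) (hp : Measurable p)
    (hp_nonneg : ∀ z, 0 < z → 0 ≤ p z) (hint : Integrable (X τ) P) (htT : t < T)
    (hlτ : T + l * t ≤ τ) (hξ : IsSplitting X t T l a ξ₁ ξ₂) :
    (P[X T | jointHistory ξ₁ ξ₂ t] =ᵐ[P] fun ω =>
      ((T : ℝ) - t) / (τ - (1 + l) * t) *
        (condMeanGiven (X τ) (X ((1 + l) * t)) P (ξ₁ t ω + a⁻¹ * ξ₂ t ω) - a⁻¹ * ξ₂ t ω) +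
      (τ - (T + l * t)) / (τ - (1 + l) * t) * ξ₁ t ω) ∧
    P[fun ω => a * (X τ ω - X T ω) | jointHistory ξ₁ ξ₂ t] =ᵐ[P] fun ω =>
      a * ((τ - (T + l * t)) / (τ - (1 + l) * t)) *
        (condMeanGiven (X τ) (X ((1 + l) * t)) P (ξ₁ t ω + a⁻¹ * ξ₂ t ω) - ξ₁ t ω) +
      ((T : ℝ) - t) / (τ - (1 + l) * t) * ξ₂ t ω := by
  have hm_hist := hξ.jointHistory_le_comap_splitHistory
  have hm := hm_hist.trans (h.measurable_splitHistory
    (htT.le.trans (le_self_add.trans hlτ)) hlτ).comap_le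
  have hpair := measurable_prodMk_jointHistory ξ₁ ξ₂ t.coe_nonneg
  have hXt : Measurable[jointHistory ξ₁ ξ₂ t] (X t) := hξ.fst_eq t le_rfl ▸ hpair.fst
  have hXs : Measurable[jointHistory ξ₁ ξ₂ t] fun ω => X (T + l * t) ω - X T ω := by
    simpa only [hξ.increment_eq] using hpair.snd.const_mul _
  have hterminal := h.condExp_terminal_ae_eq_condMeanGiven hS hc hp hp_nonneg hint htT hlτ hm
    hm_hist (hXt.add hXs)
  have hfirst := h.condExp_intermediate hS hint htT hlτ hm hm_hist hXt hXs
  have hsecond := h.condExp_terminal_sub_intermediate hS hint htT hlτ hm hm_hist hXt hXs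
  simp only [NNReal.coe_mul, ← one_add_mul, hξ.increment_eq, ← hξ.fst_eq t le_rfl]
    at hterminal hfirst hsecond
  constructor
  · filter_upwards [hterminal, hfirst] with ω hterminal hfirst
    rw [hfirst, hterminal]
  · filter_upwards [hterminal, hsecond,
      condExp_smul a (fun ω => X τ ω - X T ω) (jointHistory ξ₁ ξ₂ t) (μ := P)] with
      ω hterminal hsecond hscale
    refine hscale.trans ?_
    rw [Pi.smul_apply, hsecond, hterminal, smul_eq_mul]
    field_simp [hξ.scale_ne_zero]

theorem condMeanGiven_pair_ae_eq (h : HasTiltedPathLaw τ (bridgeWeight c τ p) X P S P')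
    (hS : IsStableHalfSubordinator c S P') (hc : 0 < c) (hp : Measurable p)
    (hp_nonneg : ∀ z, 0 < z → 0 ≤ p z) (hint : Integrable (X τ) P) (htT : t < T)
    (hlτ : T + l * t ≤ τ) (hξ : IsSplitting X t T l a ξ₁ ξ₂) :
    ∀ᵐ x ∂(P.map fun ω => (ξ₁ t ω, ξ₂ t ω)),
      condMeanGiven (X T) (fun ω => (ξ₁ t ω, ξ₂ t ω)) P x =
        ((T : ℝ) - t) / (τ - (1 + l) * t) *
          (condMeanGiven (X τ) (X ((1 + l) * t)) P (x.1 + a⁻¹ * x.2) - a⁻¹ * x.2) +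
        (τ - (T + l * t)) / (τ - (1 + l) * t) * x.1 ∧
      condMeanGiven (fun ω => a * (X τ ω - X T ω)) (fun ω => (ξ₁ t ω, ξ₂ t ω)) P x =
        a * ((τ - (T + l * t)) / (τ - (1 + l) * t)) *
          (condMeanGiven (X τ) (X ((1 + l) * t)) P (x.1 + a⁻¹ * x.2) - x.1) +
        ((T : ℝ) - t) / (τ - (1 + l) * t) * x.2 := by
  have hTτ : T ≤ τ := le_self_add.trans hlτ
  have hm := hξ.jointHistory_le_comap_splitHistory.trans
    (h.measurable_splitHistory (htT.le.trans hTτ) hlτ).comap_le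
  have hpair := measurable_prodMk_jointHistory ξ₁ ξ₂ t.coe_nonneg
  have hint_T := h.integrable hS hint hTτ
  have hmean : Measurable (condMeanGiven (X τ) (X ((1 + l) * t)) P) := measurable_condMeanGiven _ _
  obtain ⟨hfirst, hsecond⟩ :=
    h.condExp_jointHistory hS hc hp hp_nonneg hint htT hlτ hξ
  exact (condMeanGiven_ae_eq_of_condExp_ae_eq hm hpair hint_T (by fun_prop) hfirst).and
    (condMeanGiven_ae_eq_of_condExp_ae_eq hm hpair ((hint.sub hint_T).const_mul a) (by fun_prop)
      hsecond)

theorem condExp_jointHistory_ae_eq_condMeanGiven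
    (h : HasTiltedPathLaw τ (bridgeWeight c τ p) X P S P')
    (hS : IsStableHalfSubordinator c S P') (hc : 0 < c) (hp : Measurable p)
    (hp_nonneg : ∀ z, 0 < z → 0 ≤ p z) (hint : Integrable (X τ) P) (htT : t < T)
    (hlτ : T + l * t ≤ τ) (hξ : IsSplitting X t T l a ξ₁ ξ₂) :
    (P[X T | jointHistory ξ₁ ξ₂ t] =ᵐ[P] fun ω =>
      condMeanGiven (X T) (fun ω => (ξ₁ t ω, ξ₂ t ω)) P (ξ₁ t ω, ξ₂ t ω)) ∧
    P[fun ω => a * (X τ ω - X T ω) | jointHistory ξ₁ ξ₂ t] =ᵐ[P] fun ω =>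
      condMeanGiven (fun ω => a * (X τ ω - X T ω)) (fun ω => (ξ₁ t ω, ξ₂ t ω)) P
        (ξ₁ t ω, ξ₂ t ω) := by
  have hm := hξ.jointHistory_le_comap_splitHistory.trans
    (h.measurable_splitHistory (htT.le.trans (le_self_add.trans hlτ)) hlτ).comap_le
  have hpair := measurable_prodMk_jointHistory ξ₁ ξ₂ t.coe_nonneg
  obtain ⟨hfirst, hsecond⟩ :=
    h.condExp_jointHistory hS hc hp hp_nonneg hint htT hlτ hξ
  have hmean := ae_of_ae_map (hpair.mono hm le_rfl).aemeasurable
    (h.condMeanGiven_pair_ae_eq hS hc hp hp_nonneg hint htT hlτ hξ)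
  constructor
  · filter_upwards [hfirst, hmean] with ω hω hmean
    rw [hω, hmean.1]
  · filter_upwards [hsecond, hmean] with ω hω hmean
    rw [hω, hmean.2]

theorem ae_condMeanGiven_eq_integral_posteriorDensity
    (h : HasTiltedPathLaw τ (bridgeWeight c τ p) X P S P')
    (hS : IsStableHalfSubordinator c S P') (hc : 0 < c) (hp : Measurable p)
    (hp_nonneg : ∀ z, 0 < z → 0 ≤ p z) (hint : Integrable (X τ) P) (htT : t < T)
    (hlτ : T + l * t ≤ τ) (hξ : IsSplitting X t T l a ξ₁ ξ₂) :
    ∀ᵐ x ∂(P.map fun ω => (ξ₁ t ω, ξ₂ t ω)),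
      ∫ z in Ioi 0, posteriorDensity c τ p ((1 + l) * t) (x.1 + a⁻¹ * x.2) z = 1 ∧
      IntegrableOn (fun z => z * posteriorDensity c τ p ((1 + l) * t) (x.1 + a⁻¹ * x.2) z)
        (Ioi 0) ∧
      condMeanGiven (X τ) (X ((1 + l) * t)) P (x.1 + a⁻¹ * x.2) =
        ∫ z in Ioi 0, z * posteriorDensity c τ p ((1 + l) * t) (x.1 + a⁻¹ * x.2) z := by
  have hsum : Measurable fun x : ℝ × ℝ => x.1 + a⁻¹ * x.2 := by fun_prop
  have hm := hξ.jointHistory_le_comap_splitHistory.trans (h.measurable_splitHistory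
    (htT.le.trans (le_self_add.trans hlτ)) hlτ).comap_le
  have hpair := (measurable_prodMk_jointHistory ξ₁ ξ₂ t.coe_nonneg).mono hm le_rfl
  have hvalue : (P.map fun ω => X t ω + (X (T + l * t) ω - X T ω)) =
      (P.map fun ω => (ξ₁ t ω, ξ₂ t ω)).map fun x => x.1 + a⁻¹ * x.2 := by
    rw [Measure.map_map hsum hpair]
    simp only [Function.comp_def, hξ.increment_eq, hξ.fst_eq t le_rfl]
  have hdensity := h.ae_integral_posteriorDensity_eq_one hS hc hp hp_nonneg hint htT hlτ
  have hmean := h.condMeanGiven_terminal_ae_eq hS hc hp hp_nonneg hint htT hlτ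
  rw [hvalue] at hdensity hmean
  filter_upwards [ae_of_ae_map hsum.aemeasurable hdensity, ae_of_ae_map hsum.aemeasurable hmean]
    with x ⟨hmass, hint⟩ hmean
  simp only [← one_add_mul, NNReal.coe_mul, NNReal.coe_add, NNReal.coe_one]
    at hmass hint hmean
  exact ⟨hmass, hint, hmean⟩

end HasTiltedPathLaw
end JointHistory

theorem IsStableHalfRandomBridge.restrict {Ω : Type*} [MeasurableSpace Ω] {P : Measure Ω}
    [IsProbabilityMeasure P] {c : ℝ} {T τ : ℝ≥0} {p : ℝ → ℝ} {S ξ : ℝ → Ω → ℝ}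
    (hS : IsStableHalfRandomBridge c τ p S P) (hc : 0 < c) (hT : 0 < T) (hTτ : T < τ)
    (hξ : ∀ t ∈ Icc 0 (T : ℝ), ∀ ω, ξ t ω = S t ω) :
    IsStableHalfRandomBridge c T
      (fun x => ∫ z in Ioi 0, stableHalfBridgeDensity c T τ x z * p z) ξ P := by
  simpa using hS.affine_increment (r := 0) (l := 1) (T := T) (b := 0) hc one_pos one_pos hT
    (by simpa using hTτ.le) (by simpa using hTτ) measurable_const
    (hS.start.mono fun ω hω => by simp [hω]) (ξ := ξ) (by simpa using hξ)

theorem mainTheorem7 {Ω : Type*} [MeasurableSpace Ω] (P : Measure Ω) [IsProbabilityMeasure P]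
    (c c₂ T Tstar lam k : ℝ) (hc : 0 < c) (hc₂ : 0 < c₂) (hT : 0 < T) (hTstar : T < Tstar)
    (hlam : lam = Tstar / T - 1) (hk : k = c₂ / (c * lam))
    (p : ℝ → ℝ) (S : ℝ → Ω → ℝ) (hS : IsStableHalfRandomBridge c Tstar p S P)
    (ξ₁ ξ₂ : ℝ → Ω → ℝ)
    (hξ₁ : ∀ t ∈ Icc 0 T, ∀ ω, ξ₁ t ω = S t ω)
    (hξ₂ : ∀ t ∈ Icc 0 T, ∀ ω, ξ₂ t ω = k ^ 2 * S (lam * t + T) ω - k ^ 2 * S T ω) :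
    IsStableHalfRandomBridge c T
      (fun x => ∫ z in Ioi 0, stableHalfBridgeDensity c T Tstar x z * p z) ξ₁ P ∧
    IsStableHalfRandomBridge c₂ T
      (fun x => (k ^ 2)⁻¹ *
        ∫ z in Ioi 0, stableHalfBridgeDensity c₂ T (lam⁻¹ * Tstar) x z * p ((k ^ 2)⁻¹ * z)) ξ₂ P ∧
    (Integrable (S Tstar) P →
      Integrable (ξ₁ T) P ∧ Integrable (ξ₂ T) P ∧
      ∀ t : ℝ, 0 ≤ t → t < T →
        -- the conditional means given the two current values
        (∀ᵐ x ∂(P.map fun ω => (ξ₁ t ω, ξ₂ t ω)),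
          condMeanGiven (ξ₁ T) (fun ω => (ξ₁ t ω, ξ₂ t ω)) P x =
              (T - t) / (Tstar - (1 + lam) * t) *
                (condMeanGiven (S Tstar) (S ((1 + lam) * t)) P (x.1 + (k ^ 2)⁻¹ * x.2)
                  - (k ^ 2)⁻¹ * x.2)
              + (Tstar - (T + lam * t)) / (Tstar - (1 + lam) * t) * x.1 ∧
          condMeanGiven (ξ₂ T) (fun ω => (ξ₁ t ω, ξ₂ t ω)) P x =
              k ^ 2 * ((Tstar - (T + lam * t)) / (Tstar - (1 + lam) * t)) *
                (condMeanGiven (S Tstar) (S ((1 + lam) * t)) P (x.1 + (k ^ 2)⁻¹ * x.2) - x.1)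
              + (T - t) / (Tstar - (1 + lam) * t) * x.2) ∧
        -- they are the best estimates given the whole history of both processes
        (P[ξ₁ T | jointHistory ξ₁ ξ₂ t] =ᵐ[P] fun ω =>
          condMeanGiven (ξ₁ T) (fun ω => (ξ₁ t ω, ξ₂ t ω)) P (ξ₁ t ω, ξ₂ t ω)) ∧
        (P[ξ₂ T | jointHistory ξ₁ ξ₂ t] =ᵐ[P] fun ω =>
          condMeanGiven (ξ₂ T) (fun ω => (ξ₁ t ω, ξ₂ t ω)) P (ξ₁ t ω, ξ₂ t ω)) ∧
        -- the posterior mean as a one-dimensional integral, at almost every pair of values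
        (∀ᵐ x ∂(P.map fun ω => (ξ₁ t ω, ξ₂ t ω)),
          ∫ z in Ioi 0, posteriorDensity c Tstar p ((1 + lam) * t) (x.1 + (k ^ 2)⁻¹ * x.2) z = 1 ∧
          IntegrableOn (fun z => z *
            posteriorDensity c Tstar p ((1 + lam) * t) (x.1 + (k ^ 2)⁻¹ * x.2) z) (Ioi 0) ∧
          condMeanGiven (S Tstar) (S ((1 + lam) * t)) P (x.1 + (k ^ 2)⁻¹ * x.2) =
            ∫ z in Ioi 0, z *
              posteriorDensity c Tstar p ((1 + lam) * t) (x.1 + (k ^ 2)⁻¹ * x.2) z)) := by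
  have hlam_pos : 0 < lam := hlam ▸ sub_pos.2 ((one_lt_div hT).2 hTstar)
  have hk_pos : 0 < k := hk ▸ by positivity
  have hactivity : k * (c * lam) = c₂ := by rw [hk]; field_simp
  lift T to ℝ≥0 using hT.le
  lift Tstar to ℝ≥0 using (hT.trans hTstar).le
  lift lam to ℝ≥0 using hlam_pos.le
  have hend : T + lam * T = Tstar := NNReal.coe_injective (by push_cast [hlam]; field_simp; ring)
  obtain ⟨Ω', _, P', _, S', hS', hlaw⟩ := hS.exists_hasTiltedPathLaw hc (hT.trans hTstar)
  have hsplit : IsSplitting (fun r : ℝ≥0 => S r) T T lam (k ^ 2) ξ₁ ξ₂ :=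
    ⟨(pow_pos hk_pos 2).ne', fun r hr => funext (hξ₁ r ⟨r.coe_nonneg, hr⟩), fun r hr =>
      funext fun ω => by rw [hξ₂ r ⟨r.coe_nonneg, hr⟩, mul_sub, add_comm]; rfl⟩
  refine ⟨hS.restrict hc hT hTstar hξ₁, hactivity ▸ hS.affine_increment hc hk_pos hlam_pos hT
    hend.le (hend ▸ lt_add_of_pos_left _ hT) ((hS.measurable T ⟨hT.le, hTstar.le⟩).const_mul _)
    (ae_of_all _ fun _ => rfl) hξ₂, fun hint => ?_⟩
  have hint_T : Integrable (S T) P := hlaw.integrable hS' hint (t := T) hTstar.le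
  rw [hsplit.fst_eq T le_rfl, hsplit.snd_eq T le_rfl, hend]
  refine ⟨hint_T, (hint.sub hint_T).const_mul _, fun t ht htT => ?_⟩
  lift t to ℝ≥0 using ht
  have htTstar : T + lam * t ≤ Tstar := hend ▸ by gcongr; exact htT.le
  have hξ := hsplit.mono htT.le
  have hp := hS.density_measurable
  have hp_nonneg := hS.density_nonneg
  have hestimates := hlaw.condMeanGiven_pair_ae_eq hS' hc hp hp_nonneg hint htT htTstar hξ
  have hbest :=
    hlaw.condExp_jointHistory_ae_eq_condMeanGiven hS' hc hp hp_nonneg hint htT htTstar hξ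
  exact ⟨hestimates, hbest.1, hbest.2,
    hlaw.ae_condMeanGiven_eq_integral_posteriorDensity hS' hc hp hp_nonneg hint htT htTstar hξ⟩
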